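/- Let $\mathbb{k}$ be a field and let $S=\mathbb{k}[y]$ be the $\mathbb{Z}$-graded polynomial ring with $|y|=1$. Write $\operatorname{gr} S$ for the category of finitely presented graded $S$-modules and degree-preserving maps, $\mathsf{D}^{\mathrm b}(\operatorname{gr} S)$ for its bounded derived category with suspension $\Sigma$, and $M(j)$ for the twist $M(j)_i=M_{i+j}$. An *arc* is a pair $(a,b)$ with $a,b\in\mathbb{Z}\sqcup\{-\infty\}$ and $a<b$. To an arc associate the module $M_{(a,b)}=S/(y^{b-a})(b)$ if $a\in\mathbb{Z}$ and $M_{(-\infty,b)}=S(b)$, regarded as a stalk complex in degree $0$. A set $\mathcal{S}$ of arcs is *saturated* if whenever $(a,b),(c,d)\in\mathcal{S}$ with $a\le c\le b\le d$, those of $(a,c),(c,b),(b,d),(a,d)$ that are arcs lie in $\mathcal{S}$; $\mathrm{sat}(\mathcal{U})$ is the smallest saturated set containing $\mathcal{U}$. For an arc $(l,m)$ put $$\mathcal{S}\perp(l,m)=\{(a,b)\in\mathcal{S}\mid \text{neither } l<a\le m<b \text{ nor } a\le l<b\le m\}.$$ For a sequence $(E_1,\dots,E_n)$ of objects of a $\mathbb{k}$-linear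 triangulated category, $(E_1,\dots,E_n)$ is an *exceptional collection* if each $E_i$ satisfies $\operatorname{End}(E_i)\cong\mathbb{k}$ and $\operatorname{Hom}(E_i,\Sigma^mE_i)=0$ for $m\ne0$, and $\operatorname{Hom}(E_j,\Sigma^mE_i)=0$ for all $m\in\mathbb{Z}$ and $j>i$. It is *strong* if moreover $\operatorname{Hom}(E_i,\Sigma^mE_j)=0$ for all $i\le j$ and $m\neq0$. **Theorem.** Let $\mathcal{F}$ be a finite set of arcs and $\mathcal{S}=\mathrm{sat}(\mathcal{F})$ (for instance, $\mathcal{S}=\mathcal{F}$ any finite saturated set of arcs). Then there are $n\ge0$ and arcs $(l_1,m_1),\dots,(l_n,m_n)\in\mathcal{S}$ such that: 1. there are sets $\mathcal{S}_0=\mathcal{S},\mathcal{S}_1,\dots,\mathcal{S}_n=\varnothing$ such that, for $1\le i\le n$, $(l_i,m_i)$ is the minimal element of $\mathcal{S}_{i-1}$ in the lexicographic order and $\mathcal{S}_i=\mathcal{S}_{i-1}\perp(l_i,m_i)$; 2. $(M_{(l_1,m_1)},\dots,M_{(l_n,m_n)})$ is a strong exceptional collection in $\mathsf{D}^{\mathrm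 b}(\operatorname{gr} S)$; 3. $\mathrm{sat}(\{(l_i,m_i)\mid 1\le i\le n\})=\mathcal{S}$; 4. there are $k\ge0$ and integers $r_1,\dots,r_k\ge1$ with $r_1+\cdots+r_k=n$ and an isomorphism of $\mathbb{k}$-algebras $$\operatorname{End}\Big(\bigoplus_{i=1}^n M_{(l_i,m_i)}\Big)\cong \mathbb{k}A_{r_1}\times\cdots\times\mathbb{k}A_{r_k},$$ where $\mathbb{k}A_r$ is the path algebra of the linearly oriented quiver of type $A_r$. -/

import Mathlib

open CategoryTheory CategoryTheory.Limits

universe u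

set_option linter.unusedSectionVars false

/-! ### Graded modules over a `ℤ`-graded commutative algebra -/

/-- A graded module over the commutative algebra `A` with `ℤ`-grading `𝒜`: a module which is the
internal direct sum of additive subgroups `deg i`, with `𝒜 i • deg j ⊆ deg (i + j)`. -/
structure GrModule {𝕜 A : Type u} [Field 𝕜] [CommRing A] [Algebra 𝕜 A]
    (𝒜 : ℤ → Submodule 𝕜 A) where
  carrier : Type u
  [addCommGroup : AddCommGroup carrier]
  [module : Module A carrier]
  deg : ℤ → AddSubgroup carrier
  internal : DirectSum.IsInternal deg
  [gradedSMul : SetLike.GradedSMul 𝒜 deg]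

namespace GrModule

section General

variable {𝕜 A : Type u} [Field 𝕜] [CommRing A] [Algebra 𝕜 A] {𝒜 : ℤ → Submodule 𝕜 A}

attribute [instance] addCommGroup module gradedSMul

/-- Morphisms of graded modules: linear maps preserving degrees. -/
@[ext]
structure Hom (M N : GrModule 𝒜) where
  lin : M.carrier →ₗ[A] N.carrier
  map_deg : ∀ (i : ℤ) (x : M.carrier), x ∈ M.deg i → lin x ∈ N.deg i

/-- The category of graded modules and degree preserving linear maps. -/
instance : Category (GrModule 𝒜) where
  Hom M N := Hom M N
  id M := ⟨LinearMap.id, fun _ _ h => h⟩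
  comp f g := ⟨g.lin ∘ₗ f.lin, fun i x h => g.map_deg i _ (f.map_deg i x h)⟩

/-- The linear map underlying a morphism of graded modules. -/
def lin {M N : GrModule 𝒜} (f : M ⟶ N) : M.carrier →ₗ[A] N.carrier := Hom.lin f

/-- Constructor for morphisms of graded modules. -/
def mkHom {M N : GrModule 𝒜} (f : M.carrier →ₗ[A] N.carrier)
    (h : ∀ (i : ℤ) (x : M.carrier), x ∈ M.deg i → f x ∈ N.deg i) : M ⟶ N :=
  Hom.mk f h

theorem lin_mem {M N : GrModule 𝒜} (f : M ⟶ N) {i : ℤ} {x : M.carrier} (h : x ∈ M.deg i) :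
    lin f x ∈ N.deg i := Hom.map_deg f i x h

@[ext]
theorem hom_ext {M N : GrModule 𝒜} {f g : M ⟶ N} (h : lin f = lin g) : f = g := Hom.ext h

@[simp] theorem lin_mkHom {M N : GrModule 𝒜} (f : M.carrier →ₗ[A] N.carrier) (h) :
    lin (mkHom (M := M) (N := N) f h) = f := rfl
@[simp] theorem lin_id (M : GrModule 𝒜) : lin (𝟙 M) = LinearMap.id := rfl
@[simp] theorem lin_comp {M N P : GrModule 𝒜} (f : M ⟶ N) (g : N ⟶ P) :
    lin (f ≫ g) = lin g ∘ₗ lin f := rfl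

section Linear

variable [GradedAlgebra 𝒜]

theorem algebraMap_smul_mem (M : GrModule 𝒜) (c : 𝕜) {i : ℤ} {x : M.carrier} (h : x ∈ M.deg i) :
    algebraMap 𝕜 A c • x ∈ M.deg i := by
  have h0 : algebraMap 𝕜 A c ∈ 𝒜 0 := SetLike.algebraMap_mem_graded 𝒜 c
  have := SetLike.GradedSMul.smul_mem (A := 𝒜) (B := M.deg) h0 h
  simpa using this

variable {M N : GrModule 𝒜}

instance : Zero (M ⟶ N) := ⟨mkHom 0 fun i _ _ => (N.deg i).zero_mem⟩
instance : Add (M ⟶ N) :=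
  ⟨fun f g => mkHom (lin f + lin g) fun i _ h => (N.deg i).add_mem (lin_mem f h) (lin_mem g h)⟩
instance : Neg (M ⟶ N) :=
  ⟨fun f => mkHom (-lin f) fun i _ h => (N.deg i).neg_mem (lin_mem f h)⟩
instance : Sub (M ⟶ N) :=
  ⟨fun f g => mkHom (lin f - lin g) fun i _ h => (N.deg i).sub_mem (lin_mem f h) (lin_mem g h)⟩
instance : SMul ℕ (M ⟶ N) :=
  ⟨fun n f => mkHom (n • lin f) fun i _ h => (N.deg i).nsmul_mem (lin_mem f h) n⟩
instance : SMul ℤ (M ⟶ N) :=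
  ⟨fun n f => mkHom (n • lin f) fun i _ h => (N.deg i).zsmul_mem (lin_mem f h) n⟩
instance : SMul 𝕜 (M ⟶ N) :=
  ⟨fun c f => mkHom (algebraMap 𝕜 A c • lin f) fun _ _ h => algebraMap_smul_mem N c (lin_mem f h)⟩

@[simp] theorem lin_zero : lin (0 : M ⟶ N) = 0 := rfl
@[simp] theorem lin_add (f g : M ⟶ N) : lin (f + g) = lin f + lin g := rfl
@[simp] theorem lin_neg (f : M ⟶ N) : lin (-f) = -lin f := rfl
@[simp] theorem lin_sub (f g : M ⟶ N) : lin (f - g) = lin f - lin g := rfl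
@[simp] theorem lin_smul (c : 𝕜) (f : M ⟶ N) : lin (c • f) = algebraMap 𝕜 A c • lin f := rfl

theorem lin_injective : Function.Injective (lin : (M ⟶ N) → (M.carrier →ₗ[A] N.carrier)) :=
  fun _ _ h => hom_ext h

instance : AddCommGroup (M ⟶ N) :=
  lin_injective.addCommGroup _ rfl (fun _ _ => rfl) (fun _ => rfl) (fun _ _ => rfl)
    (fun _ _ => rfl) (fun _ _ => rfl)

instance : Preadditive (GrModule 𝒜) where
  add_comp _ _ _ f f' g := by ext x; simp
  comp_add _ _ _ f g g' := by ext x; simp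

instance : Module 𝕜 (M ⟶ N) where
  one_smul f := by ext x; simp
  mul_smul a b f := by ext x; simp [mul_smul]
  smul_zero a := by ext x; simp
  smul_add a f g := by ext x; simp
  add_smul a b f := by ext x; simp [add_smul]
  zero_smul f := by ext x; simp

instance : Linear 𝕜 (GrModule 𝒜) where
  smul_comp _ _ _ r f g := by ext x; simp
  comp_smul _ _ _ f r g := by ext x; simp

end Linear

/-! #### Homogeneous components -/

/-- A criterion for a family of subgroups to be a grading. -/
theorem isInternal_of_proj {X : Type u} [AddCommGroup X] (D : ℤ → AddSubgroup X)
    (p : ℤ → X →+ X) (hp : ∀ i, ∀ x ∈ D i, p i x = x)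
    (hp' : ∀ i j, i ≠ j → ∀ x ∈ D j, p i x = 0)
    (hs : ∀ x : X, x ∈ AddMonoidHom.range (DirectSum.coeAddMonoidHom D)) :
    DirectSum.IsInternal D := by
  refine ⟨?_, hs⟩
  have key : ∀ (i : ℤ) (x : DirectSum ℤ fun i => D i),
      p i (DirectSum.coeAddMonoidHom D x) = x i := by
    intro i x
    induction x using DirectSum.induction_on with
    | zero => simp
    | of j y =>
      rw [DirectSum.coeAddMonoidHom_of]
      by_cases h : i = j
      · subst h
        rw [hp i _ y.2, DirectSum.of_eq_same]
      · rw [hp' i j h _ y.2, DirectSum.of_eq_of_ne _ _ _ h]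
        simp
    | add x y hx hy => simp [hx, hy]
  intro x y hxy
  ext i
  rw [← key i x, ← key i y, hxy]

/-- The homogeneous decomposition of a graded module. -/
noncomputable instance (M : GrModule 𝒜) : DirectSum.Decomposition M.deg :=
  M.internal.chooseDecomposition

/-- The homogeneous component of degree `i`. -/
noncomputable def comp (M : GrModule 𝒜) (i : ℤ) : M.carrier →+ M.carrier where
  toFun x := (DirectSum.decompose M.deg x i : M.carrier)
  map_zero' := by simp
  map_add' := by simp

theorem comp_mem (M : GrModule 𝒜) (i : ℤ) (x : M.carrier) : M.comp i x ∈ M.deg i :=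
  (DirectSum.decompose M.deg x i).2

theorem comp_same (M : GrModule 𝒜) (i : ℤ) {x : M.carrier} (h : x ∈ M.deg i) :
    M.comp i x = x := DirectSum.decompose_of_mem_same _ h

theorem comp_ne (M : GrModule 𝒜) {i j : ℤ} (hij : i ≠ j) {x : M.carrier} (h : x ∈ M.deg j) :
    M.comp i x = 0 := DirectSum.decompose_of_mem_ne _ h hij.symm

theorem induction (M : GrModule 𝒜) {P : M.carrier → Prop} (h0 : P 0)
    (hh : ∀ i x, x ∈ M.deg i → P x) (ha : ∀ x y, P x → P y → P (x + y)) (x) : P x :=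
  DirectSum.Decomposition.inductionOn M.deg h0 (fun m => hh _ _ m.2) ha x

theorem comp_smul (M : GrModule 𝒜) {a : A} {n : ℤ} (ha : a ∈ 𝒜 n) (i : ℤ) (x : M.carrier) :
    M.comp i (a • x) = a • M.comp (i - n) x := by
  induction x using M.induction with
  | h0 => simp
  | hh j x hx =>
    have hm : a • x ∈ M.deg (n + j) :=
      SetLike.GradedSMul.smul_mem (A := 𝒜) (B := M.deg) ha hx
    by_cases h : i = n + j
    · subst h
      rw [comp_same _ _ hm, comp_same _ _ (by simpa using hx)]
    · rw [comp_ne _ h hm, comp_ne _ (by omega) hx, smul_zero]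
  | ha x y hx hy => simp [hx, hy]

theorem lin_component {M N : GrModule 𝒜} (f : M ⟶ N) (i : ℤ) (x : M.carrier) :
    lin f (M.comp i x) = N.comp i (lin f x) := by
  induction x using M.induction with
  | h0 => simp
  | hh j x hx =>
    by_cases h : i = j
    · subst h
      rw [comp_same _ _ hx, comp_same _ _ (lin_mem f hx)]
    · rw [comp_ne _ h hx, comp_ne _ h (lin_mem f hx), map_zero]
  | ha x y hx hy => simp [hx, hy]

/-! #### Submodules, quotients, products, twists -/

/-- The graded submodule on a homogeneous submodule. -/
@[simps carrier]
def sub (M : GrModule 𝒜) (N : Submodule A M.carrier)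
    (hN : ∀ i, ∀ x ∈ N, M.comp i x ∈ N) : GrModule 𝒜 where
  carrier := N
  deg i := (M.deg i).comap N.subtype.toAddMonoidHom
  internal := by
    refine isInternal_of_proj _
      (fun i => ((M.comp i).comp N.subtype.toAddMonoidHom).codRestrict N fun x => hN i x x.2)
      ?_ ?_ ?_
    · intro i x hx
      exact Subtype.ext (M.comp_same i hx)
    · intro i j hij x hx
      exact Subtype.ext (M.comp_ne hij hx)
    · intro x
      classical
      have : x = ∑ i ∈ (DirectSum.decompose M.deg (x : M.carrier)).support,
          (⟨M.comp i x, hN i x x.2⟩ : N) := by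
        apply Subtype.ext
        rw [AddSubmonoidClass.coe_finsetSum]
        exact (DirectSum.sum_support_decompose M.deg (x : M.carrier)).symm
      rw [this]
      refine sum_mem fun i _ => ⟨DirectSum.of _ i ⟨⟨M.comp i x, hN i x x.2⟩, M.comp_mem i x⟩, ?_⟩
      rw [DirectSum.coeAddMonoidHom_of]
  gradedSMul := ⟨fun {_ _ a b} ha hb =>
    SetLike.GradedSMul.smul_mem (A := 𝒜) (B := M.deg) (bj := (b : M.carrier)) ha hb⟩

/-- The graded quotient module by a homogeneous submodule. -/
@[simps carrier]
def quot (M : GrModule 𝒜) (N : Submodule A M.carrier)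
    (hN : ∀ i, ∀ x ∈ N, M.comp i x ∈ N) : GrModule 𝒜 where
  carrier := M.carrier ⧸ N
  deg i := (M.deg i).map N.mkQ.toAddMonoidHom
  internal := by
    refine isInternal_of_proj _
      (fun i => QuotientAddGroup.map N.toAddSubgroup N.toAddSubgroup (M.comp i)
        (fun x hx => hN i x hx))
      ?_ ?_ ?_
    · rintro i _ ⟨x, hx, rfl⟩
      exact congrArg N.mkQ (M.comp_same i hx)
    · rintro i j hij _ ⟨x, hx, rfl⟩
      exact (congrArg N.mkQ (M.comp_ne hij hx)).trans (map_zero _)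
    · intro x
      obtain ⟨x, rfl⟩ := N.mkQ_surjective x
      induction x using M.induction with
      | h0 => rw [map_zero]; exact zero_mem _
      | hh i x hx =>
        refine ⟨DirectSum.of _ i ⟨N.mkQ x, x, hx, rfl⟩, ?_⟩
        rw [DirectSum.coeAddMonoidHom_of]
      | ha x y hx hy => rw [map_add]; exact add_mem hx hy
  gradedSMul := ⟨by
    rintro i j a _ ha ⟨x, hx, rfl⟩
    exact ⟨a • x, SetLike.GradedSMul.smul_mem (A := 𝒜) (B := M.deg) ha hx, rfl⟩⟩

/-- The direct sum of two graded modules. -/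
@[simps carrier]
def prod (M N : GrModule 𝒜) : GrModule 𝒜 where
  carrier := M.carrier × N.carrier
  deg i := (M.deg i).prod (N.deg i)
  internal := by
    refine isInternal_of_proj _ (fun i => (M.comp i).prodMap (N.comp i)) ?_ ?_ ?_
    · rintro i ⟨x, y⟩ ⟨hx, hy⟩
      exact Prod.ext (M.comp_same i hx) (N.comp_same i hy)
    · rintro i j hij ⟨x, y⟩ ⟨hx, hy⟩
      exact Prod.ext (M.comp_ne hij hx) (N.comp_ne hij hy)
    · rintro ⟨x, y⟩
      have h : (x, y) = (x, 0) + (0, y) := by simp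
      rw [h]
      refine add_mem ?_ ?_
      · induction x using M.induction with
        | h0 => exact zero_mem _
        | hh i x hx =>
          refine ⟨DirectSum.of _ i ⟨(x, 0), hx, (N.deg i).zero_mem⟩, ?_⟩
          rw [DirectSum.coeAddMonoidHom_of]
        | ha x y hx hy =>
          have : ((x + y, 0) : M.carrier × N.carrier) = (x, 0) + (y, 0) := by simp
          rw [this]; exact add_mem (hx (by simp)) (hy (by simp))
      · induction y using N.induction with
        | h0 => exact zero_mem _
        | hh i x hx =>
          refine ⟨DirectSum.of _ i ⟨(0, x), (M.deg i).zero_mem, hx⟩, ?_⟩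
          rw [DirectSum.coeAddMonoidHom_of]
        | ha x y hx hy =>
          have : ((0, x + y) : M.carrier × N.carrier) = (0, x) + (0, y) := by simp
          rw [this]; exact add_mem (hx (by simp)) (hy (by simp))
  gradedSMul := ⟨by
    rintro i j a ⟨x, y⟩ ha ⟨hx, hy⟩
    exact ⟨SetLike.GradedSMul.smul_mem (A := 𝒜) (B := M.deg) ha hx,
      SetLike.GradedSMul.smul_mem (A := 𝒜) (B := N.deg) ha hy⟩⟩

/-- The twist `M(j)`, with `M(j)_i = M_{i+j}`. -/
@[simps carrier]
def twist (M : GrModule 𝒜) (j : ℤ) : GrModule 𝒜 where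
  carrier := M.carrier
  deg i := M.deg (i + j)
  internal := by
    refine isInternal_of_proj _ (fun i => M.comp (i + j)) ?_ ?_ ?_
    · intro i x hx
      exact M.comp_same _ hx
    · intro i i' hi x hx
      exact M.comp_ne (by omega) hx
    · intro x
      induction x using M.induction with
      | h0 => exact zero_mem _
      | hh i x hx =>
        refine ⟨DirectSum.of (fun i => M.deg (i + j)) (i - j) ⟨x, by simpa using hx⟩, ?_⟩
        rw [DirectSum.coeAddMonoidHom_of]
      | ha x y hx hy => exact add_mem hx hy
  gradedSMul := ⟨by
    intro i i' a x ha hx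
    have := SetLike.GradedSMul.smul_mem (A := 𝒜) (B := M.deg) ha hx
    simpa [add_assoc] using this⟩

/-- The graded algebra as a graded module over itself. -/
@[simps carrier]
def self (𝒜 : ℤ → Submodule 𝕜 A) [GradedAlgebra 𝒜] : GrModule 𝒜 where
  carrier := A
  deg i := (𝒜 i).toAddSubgroup
  internal := DirectSum.Decomposition.isInternal 𝒜
  gradedSMul := ⟨fun {_ _ _ _} ha hb => SetLike.mul_mem_graded (A := 𝒜) ha hb⟩

/-! #### The category of graded modules is abelian -/

variable [GradedAlgebra 𝒜]

section Kernels

variable {M N : GrModule 𝒜} (f : M ⟶ N)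

/-- The kernel of a morphism, as a graded submodule. -/
def ker : GrModule 𝒜 := M.sub (LinearMap.ker (lin f)) fun i x hx => by
  rw [LinearMap.mem_ker, lin_component, LinearMap.mem_ker.1 hx, map_zero]

/-- The inclusion of the kernel. -/
def kerι : ker f ⟶ M := mkHom (LinearMap.ker (lin f)).subtype fun _ _ h => h

/-- The cokernel of a morphism, as a graded quotient. -/
def coker : GrModule 𝒜 := N.quot (LinearMap.range (lin f)) fun i x hx => by
  obtain ⟨y, rfl⟩ := hx
  exact ⟨M.comp i y, lin_component f i y⟩

/-- The projection onto the cokernel. -/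
def cokerπ : N ⟶ coker f := mkHom (LinearMap.range (lin f)).mkQ fun _ x h => ⟨x, h, rfl⟩

theorem kerι_comp : kerι f ≫ f = 0 := by
  ext x; exact x.2

theorem comp_cokerπ : f ≫ cokerπ f = 0 := by
  ext x
  exact (Submodule.Quotient.mk_eq_zero _).2 ⟨x, rfl⟩

theorem lin_apply_eq_zero {P : GrModule 𝒜} {f : M ⟶ N} {g : N ⟶ P} (h : f ≫ g = 0)
    (x : M.carrier) : lin g (lin f x) = 0 := by
  have := congrArg (fun k => lin k x) h
  simpa using this

/-- An injective morphism is a kernel of any morphism whose kernel is its range. -/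
noncomputable def isLimitOfExact {P : GrModule 𝒜} (f : M ⟶ N) (g : N ⟶ P) (w : f ≫ g = 0)
    (hf : Function.Injective (lin f))
    (he : ∀ y, lin g y = 0 → ∃ x, lin f x = y) : IsLimit (KernelFork.ofι f w) :=
  Fork.IsLimit.mk _
    (fun s => mkHom
      ((LinearEquiv.ofInjective (lin f) hf).symm.toLinearMap ∘ₗ
        (lin s.ι).codRestrict (LinearMap.range (lin f))
          (fun x => he _ (lin_apply_eq_zero (KernelFork.condition s) x)))
      (by
        intro i x hx
        set y := ((LinearEquiv.ofInjective (lin f) hf).symm.toLinearMap ∘ₗ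
          (lin s.ι).codRestrict (LinearMap.range (lin f))
          (fun x => he _ (lin_apply_eq_zero (KernelFork.condition s) x))) x with hy
        have h1 : lin f y = lin s.ι x := by
          have := LinearEquiv.apply_symm_apply (LinearEquiv.ofInjective (lin f) hf)
            ⟨lin s.ι x, he _ (lin_apply_eq_zero (KernelFork.condition s) x)⟩
          exact congrArg Subtype.val this
        have h2 : M.comp i y = y := by
          apply hf
          rw [lin_component, h1, comp_same _ _ (lin_mem s.ι hx)]
        rw [← h2]
        exact M.comp_mem i y))
    (fun s => by
      ext x
      have := LinearEquiv.apply_symm_apply (LinearEquiv.ofInjective (lin f) hf)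
            ⟨lin s.ι x, he _ (lin_apply_eq_zero (KernelFork.condition s) x)⟩
      exact congrArg Subtype.val this)
    (fun s m hm => by
      ext x
      apply hf
      have h1 : lin f (lin m x) = lin s.ι x := congrArg (fun k => lin k x) hm
      rw [h1]
      have := LinearEquiv.apply_symm_apply (LinearEquiv.ofInjective (lin f) hf)
            ⟨lin s.ι x, he _ (lin_apply_eq_zero (KernelFork.condition s) x)⟩
      exact (congrArg Subtype.val this).symm)

/-- A surjective morphism is a cokernel of any morphism whose range is its kernel. -/
noncomputable def isColimitOfExact {P : GrModule 𝒜} (f : M ⟶ N) (g : N ⟶ P) (w : f ≫ g = 0)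
    (hg : Function.Surjective (lin g))
    (he : ∀ y, lin g y = 0 → ∃ x, lin f x = y) : IsColimit (CokernelCofork.ofπ g w) :=
  have hk : ∀ s : CokernelCofork f, LinearMap.ker (lin g) ≤ LinearMap.ker (lin s.π) := by
    intro s y hy
    obtain ⟨x, rfl⟩ := he y hy
    exact lin_apply_eq_zero (CokernelCofork.condition s) x
  have hd : ∀ (s : CokernelCofork f) (y : N.carrier),
      ((LinearMap.ker (lin g)).liftQ (lin s.π) (hk s) ∘ₗ
        ((lin g).quotKerEquivOfSurjective hg).symm.toLinearMap) (lin g y) = lin s.π y := by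
    intro s y
    have h1 : ((lin g).quotKerEquivOfSurjective hg).symm (lin g y)
        = (LinearMap.ker (lin g)).mkQ y := by
      rw [LinearEquiv.symm_apply_eq]
      rfl
    rw [LinearMap.comp_apply, LinearEquiv.coe_coe, h1]
    rfl
  Cofork.IsColimit.mk _
    (fun s => mkHom
      ((LinearMap.ker (lin g)).liftQ (lin s.π) (hk s) ∘ₗ
        ((lin g).quotKerEquivOfSurjective hg).symm.toLinearMap)
      (by
        intro i x hx
        obtain ⟨y, rfl⟩ := hg x
        have h2 : lin g (N.comp i y) = lin g y :=
          (lin_component g i y).trans (P.comp_same i hx)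
        rw [← h2, hd s]
        exact lin_mem s.π (N.comp_mem i y)))
    (fun s => by
      ext y
      exact hd s y)
    (fun s m hm => by
      ext x
      obtain ⟨y, rfl⟩ := hg x
      have h1 : lin m (lin g y) = lin s.π y := congrArg (fun k => lin k y) hm
      rw [h1]
      exact (hd s y).symm)

theorem kerι_injective : Function.Injective (lin (kerι f)) := Subtype.val_injective

theorem cokerπ_surjective : Function.Surjective (lin (cokerπ f)) := Submodule.mkQ_surjective _

theorem cokerπ_eq_zero {y : N.carrier} (h : lin (cokerπ f) y = 0) : ∃ x, lin f x = y :=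
  (Submodule.Quotient.mk_eq_zero (LinearMap.range (lin f))).1 h

instance : HasKernels (GrModule 𝒜) where
  has_limit f := ⟨⟨⟨_, isLimitOfExact (kerι f) f (kerι_comp f) (kerι_injective f)
    fun y hy => ⟨⟨y, hy⟩, rfl⟩⟩⟩⟩

instance : HasCokernels (GrModule 𝒜) where
  has_colimit f := ⟨⟨⟨_, isColimitOfExact f (cokerπ f) (comp_cokerπ f) (cokerπ_surjective f)
    fun _ hy => cokerπ_eq_zero f hy⟩⟩⟩

theorem injective_of_mono [Mono f] : Function.Injective (lin f) := by
  have h : kerι f = 0 := by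
    rw [← cancel_mono f, kerι_comp, zero_comp]
  rw [← LinearMap.ker_eq_bot, LinearMap.ker_eq_bot']
  intro x hx
  exact congrArg (fun k => lin k (⟨x, hx⟩ : LinearMap.ker (lin f))) h

theorem surjective_of_epi [Epi f] : Function.Surjective (lin f) := by
  have h : cokerπ f = 0 := by
    rw [← cancel_epi f, comp_cokerπ, comp_zero]
  intro y
  exact cokerπ_eq_zero f (congrArg (fun k => lin k y) h)

end Kernels

/-- The zero graded module. -/
instance : HasZeroObject (GrModule 𝒜) where
  zero := by
    refine ⟨(self 𝒜).sub ⊥ (fun i x hx => ?_), ?_⟩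
    · rw [(Submodule.mem_bot A).1 hx, map_zero]
      exact zero_mem _
    · rw [IsZero.iff_id_eq_zero]
      ext x
      exact Subsingleton.elim (α := (⊥ : Submodule A A)) _ _

instance : HasBinaryBiproducts (GrModule 𝒜) where
  has_binary_biproduct M N := hasBinaryBiproduct_of_total
    { pt := prod M N
      fst := mkHom (LinearMap.fst A M.carrier N.carrier) fun _ _ h => h.1
      snd := mkHom (LinearMap.snd A M.carrier N.carrier) fun _ _ h => h.2
      inl := mkHom (LinearMap.inl A M.carrier N.carrier) fun i _ h => ⟨h, (N.deg i).zero_mem⟩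
      inr := mkHom (LinearMap.inr A M.carrier N.carrier) fun i _ h => ⟨(M.deg i).zero_mem, h⟩
      inl_fst := rfl
      inl_snd := rfl
      inr_fst := rfl
      inr_snd := rfl }
    (by
      apply hom_ext
      refine LinearMap.ext ?_
      rintro ⟨x, y⟩
      exact Prod.ext (add_zero x) (zero_add y))

noncomputable instance : Abelian (GrModule 𝒜) where
  has_finite_products := hasFiniteProducts_of_has_binary_and_terminal
  normalMonoOfMono f _ := ⟨⟨coker f, cokerπ f, comp_cokerπ f,
    isLimitOfExact _ _ _ (injective_of_mono f) fun _ hy => cokerπ_eq_zero f hy⟩⟩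
  normalEpiOfEpi f _ := ⟨⟨ker f, kerι f, kerι_comp f,
    isColimitOfExact _ _ _ (surjective_of_epi f) fun y hy => ⟨⟨y, hy⟩, rfl⟩⟩⟩

/-! #### Finitely presented graded modules -/

/-- The property of being finitely presented. -/
def isFP (𝒜 : ℤ → Submodule 𝕜 A) [GradedAlgebra 𝒜] : ObjectProperty (GrModule 𝒜) :=
  fun M => Module.FinitePresentation A M.carrier

theorem isFP_iff [IsNoetherianRing A] (M : GrModule 𝒜) :
    isFP 𝒜 M ↔ Module.Finite A M.carrier :=
  (Module.finitePresentation_iff_finite A M.carrier)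

instance [IsNoetherianRing A] : (isFP 𝒜).IsClosedUnderSubobjects where
  prop_of_mono {M N} f _ h := by
    rw [isFP_iff] at h ⊢
    exact Module.Finite.of_injective (lin f) (injective_of_mono f)

instance [IsNoetherianRing A] : (isFP 𝒜).IsClosedUnderQuotients where
  prop_of_epi {M N} f _ h := by
    rw [isFP_iff] at h ⊢
    exact Module.Finite.of_surjective (lin f) (surjective_of_epi f)

instance [IsNoetherianRing A] : (isFP 𝒜).ContainsZero where
  exists_zero := ⟨(self 𝒜).sub ⊥ (fun i x hx => by
      rw [(Submodule.mem_bot A).1 hx, map_zero]; exact zero_mem _), by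
        rw [IsZero.iff_id_eq_zero]
        ext x
        exact Subsingleton.elim (α := (⊥ : Submodule A A)) _ _, by
        rw [isFP_iff]
        exact inferInstanceAs (Module.Finite A (⊥ : Submodule A A))⟩

instance [IsNoetherianRing A] : (isFP 𝒜).IsClosedUnderBinaryProducts where
  limitsOfShape_le := by
    rintro X ⟨p, hp⟩
    let M := p.diag.obj ⟨WalkingPair.left⟩
    let N := p.diag.obj ⟨WalkingPair.right⟩
    have hM : isFP 𝒜 M := hp _
    have hN : isFP 𝒜 N := hp _
    let a : X ⟶ M := p.π.app ⟨WalkingPair.left⟩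
    let b : X ⟶ N := p.π.app ⟨WalkingPair.right⟩
    let f : X ⟶ prod M N := mkHom ((lin a).prod (lin b))
      fun _ _ h => ⟨lin_mem a h, lin_mem b h⟩
    have hf : Mono f := ⟨fun {Z} u v huv => by
      refine p.isLimit.hom_ext ?_
      rintro ⟨_ | _⟩
      · exact hom_ext (LinearMap.ext fun z =>
          congrArg Prod.fst (congrArg (fun k => lin k z) huv))
      · exact hom_ext (LinearMap.ext fun z =>
          congrArg Prod.snd (congrArg (fun k => lin k z) huv))⟩
    refine (isFP 𝒜).prop_of_mono f ?_
    rw [isFP_iff] at hM hN ⊢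
    exact inferInstanceAs (Module.Finite A (M.carrier × N.carrier))

instance [IsNoetherianRing A] : (isFP 𝒜).IsClosedUnderFiniteProducts :=
  ObjectProperty.IsClosedUnderFiniteProducts.mk'

end General

end GrModule

/-! ### The graded polynomial ring and its derived category -/

section Poly

open Polynomial

variable (𝕜 : Type u) [Field 𝕜]

/-- The grading of `S = 𝕜[y]` with `y` in degree `1`: the degree `i` part consists of the
polynomials all of whose monomials have degree `i`. -/
def polyGrading (i : ℤ) : Submodule 𝕜 𝕜[X] where
  carrier := {p | ∀ n : ℕ, p.coeff n ≠ 0 → (n : ℤ) = i}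
  zero_mem' := by simp
  add_mem' {p q} hp hq n hn := by
    by_contra h
    have h1 : p.coeff n = 0 := by by_contra h1; exact h (hp n h1)
    have h2 : q.coeff n = 0 := by by_contra h2; exact h (hq n h2)
    exact hn (by simp [h1, h2])
  smul_mem' c p hp n hn := hp n fun h => hn (by simp [h])

variable {𝕜}

theorem mem_polyGrading {i : ℤ} {p : 𝕜[X]} :
    p ∈ polyGrading 𝕜 i ↔ ∀ n : ℕ, p.coeff n ≠ 0 → (n : ℤ) = i := Iff.rfl

theorem monomial_mem_polyGrading (n : ℕ) (c : 𝕜) : monomial n c ∈ polyGrading 𝕜 n := by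
  intro m hm
  by_contra h
  exact hm (coeff_monomial_of_ne c (by exact_mod_cast h))

instance : SetLike.GradedMonoid (polyGrading 𝕜) where
  one_mem := by
    have := monomial_mem_polyGrading 0 (1 : 𝕜)
    simpa using this
  mul_mem i j p q hp hq n hn := by
    rw [coeff_mul] at hn
    obtain ⟨x, hx, hne⟩ := Finset.exists_ne_zero_of_sum_ne_zero hn
    have h1 := hp x.1 (left_ne_zero_of_mul hne)
    have h2 := hq x.2 (right_ne_zero_of_mul hne)
    rw [Finset.HasAntidiagonal.mem_antidiagonal] at hx
    omega

theorem isInternal_polyGrading : DirectSum.IsInternal (polyGrading 𝕜) := by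
  refine GrModule.isInternal_of_proj (fun i => (polyGrading 𝕜 i).toAddSubgroup)
    (fun i => if 0 ≤ i then
      ((monomial i.toNat).comp (lcoeff 𝕜 i.toNat)).toAddMonoidHom else 0) ?_ ?_ ?_
  · intro i p hp
    ext n
    by_cases hi : 0 ≤ i
    · simp only [hi, if_true, LinearMap.toAddMonoidHom_coe, LinearMap.comp_apply,
        lcoeff_apply, coeff_monomial]
      split_ifs with h
      · rw [h]
      · by_contra hne
        have := hp n (Ne.symm hne)
        omega
    · simp only [hi, if_false, AddMonoidHom.zero_apply, coeff_zero]
      by_contra hne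
      have := hp n (Ne.symm hne)
      omega
  · intro i j hij p hp
    by_cases hi : 0 ≤ i
    · simp only [hi, if_true, LinearMap.toAddMonoidHom_coe, LinearMap.comp_apply, lcoeff_apply]
      rw [monomial_eq_zero_iff]
      by_contra hne
      have := hp _ hne
      omega
    · simp [hi]
  · intro p
    induction p using Polynomial.induction_on' with
    | add p q hp hq => exact add_mem hp hq
    | monomial n c =>
      refine ⟨DirectSum.of (fun i => (polyGrading 𝕜 i).toAddSubgroup) n
        ⟨monomial n c, monomial_mem_polyGrading n c⟩, ?_⟩
      rw [DirectSum.coeAddMonoidHom_of]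

noncomputable instance : GradedAlgebra (polyGrading 𝕜) where
  toDecomposition := isInternal_polyGrading.chooseDecomposition

theorem span_homogeneous (n : ℕ) (i : ℤ) (p : 𝕜[X])
    (hp : p ∈ Ideal.span {(X : 𝕜[X]) ^ n}) :
    (GrModule.self (polyGrading 𝕜)).comp i p ∈ Ideal.span {(X : 𝕜[X]) ^ n} := by
  obtain ⟨q, rfl⟩ := Ideal.mem_span_singleton.1 hp
  have hX : (X : 𝕜[X]) ^ n ∈ polyGrading 𝕜 n := by
    rw [X_pow_eq_monomial]
    exact monomial_mem_polyGrading n 1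
  exact Ideal.mem_span_singleton.2
    ⟨_, (GrModule.self (polyGrading 𝕜)).comp_smul hX i q⟩

variable (𝕜)

/-- The category `gr S` of finitely presented graded modules over `S = 𝕜[y]`. -/
abbrev GrS : Type (u + 1) := (GrModule.isFP (polyGrading 𝕜)).FullSubcategory

noncomputable instance : HasDerivedCategory (GrS 𝕜) := HasDerivedCategory.standard _

/-- The bounded derived category `D^b(gr S)`. -/
abbrev DbGrS : Type (u + 1) := DerivedCategory.Bounded (GrS 𝕜)

/-- A finitely presented graded `S`-module, viewed as an object of `D^b(gr S)` by placing it
in cohomological degree `0`. -/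
noncomputable def stalk (M : GrS 𝕜) : DbGrS 𝕜 :=
  ⟨(DerivedCategory.singleFunctor (GrS 𝕜) 0).obj M, ⟨0, inferInstance⟩, ⟨0, inferInstance⟩⟩

/-- The graded module `S(j)`. -/
noncomputable def freeS (j : ℤ) : GrS 𝕜 :=
  ⟨(GrModule.self (polyGrading 𝕜)).twist j, by
    rw [GrModule.isFP_iff]
    exact inferInstanceAs (Module.Finite 𝕜[X] 𝕜[X])⟩

/-- The graded module `S/(y^n)(j)`. -/
noncomputable def cyclicS (n : ℕ) (j : ℤ) : GrS 𝕜 :=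
  ⟨((GrModule.self (polyGrading 𝕜)).quot (Ideal.span {(X : 𝕜[X]) ^ n})
      (span_homogeneous n)).twist j, by
    rw [GrModule.isFP_iff]
    exact inferInstanceAs (Module.Finite 𝕜[X] (𝕜[X] ⧸ Ideal.span {(X : 𝕜[X]) ^ n}))⟩

end Poly

/-! ### Arcs -/

/-- Arcs: pairs `(a, b)` with `a < b` in `ℤ ⊔ {-∞}`. -/
@[ext]
structure Arc where
  src : WithBot ℤ
  tgt : WithBot ℤ
  lt : src < tgt

namespace Arc

/-- The right endpoint of an arc, which is never `-∞`. -/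
def tgtInt (p : Arc) : ℤ := p.tgt.unbot (ne_bot_of_gt p.lt)

/-- The indecomposable graded module of an arc `(a, b)`: it is `S(b)` if `a = -∞`, and
`S/(y^(b-a))(b)` if `a` is an integer. -/
noncomputable def module (𝕜 : Type u) [Field 𝕜] (p : Arc) : GrS 𝕜 :=
  WithBot.recBotCoe (C := fun _ => GrS 𝕜) (freeS 𝕜 p.tgtInt)
    (fun a : ℤ => cyclicS 𝕜 (p.tgtInt - a).toNat p.tgtInt) p.src

/-- The object `M_(a,b)` of `D^b(gr S)`. -/
noncomputable def obj (𝕜 : Type u) [Field 𝕜] (p : Arc) : DbGrS 𝕜 := stalk 𝕜 (p.module 𝕜)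

/-- A set of arcs is saturated if whenever it contains `(a, b)` and `(c, d)` with
`a ≤ c ≤ b ≤ d`, it also contains those of `(a, c)`, `(c, b)`, `(b, d)`, `(a, d)` that are arcs. -/
def IsSaturated (S : Set Arc) : Prop :=
  ∀ p ∈ S, ∀ q ∈ S, p.src ≤ q.src → q.src ≤ p.tgt → p.tgt ≤ q.tgt →
    (∀ h : p.src < q.src, ⟨p.src, q.src, h⟩ ∈ S) ∧
    (∀ h : q.src < p.tgt, ⟨q.src, p.tgt, h⟩ ∈ S) ∧
    (∀ h : p.tgt < q.tgt, ⟨p.tgt, q.tgt, h⟩ ∈ S) ∧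
    (∀ h : p.src < q.tgt, ⟨p.src, q.tgt, h⟩ ∈ S)

/-- The saturation of a set of arcs: the smallest saturated set containing it. -/
def sat (U : Set Arc) : Set Arc := ⋂₀ {T | IsSaturated T ∧ U ⊆ T}

/-- `p` is the minimal arc of `S` for the lexicographic order. -/
def IsMinimalArc (S : Set Arc) (p : Arc) : Prop :=
  p ∈ S ∧ ∀ q ∈ S, toLex (p.src, p.tgt) ≤ toLex (q.src, q.tgt)

/-- The perpendicular `S ⊥ (l, m)`: the arcs `(a, b)` of `S` for which neither `l < a ≤ m < b`
nor `a ≤ l < b ≤ m` holds. -/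
def perp (S : Set Arc) (p : Arc) : Set Arc :=
  {q ∈ S | ¬ (p.src < q.src ∧ q.src ≤ p.tgt ∧ p.tgt < q.tgt) ∧
    ¬ (q.src ≤ p.src ∧ p.src < q.tgt ∧ q.tgt ≤ p.tgt)}

/-- `E = (E_1, …, E_n)` is obtained from `S` by iterating minimal arcs and perpendiculars until
nothing is left: there are `S_0 = S, S_1, …, S_n = ∅` such that `E_i` is the minimal arc of
`S_(i-1)` and `S_i = S_(i-1) ⊥ E_i`. -/
def IsMinimalArcSequence (S : Set Arc) {n : ℕ} (E : Fin n → Arc) : Prop :=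
  ∃ T : Fin (n + 1) → Set Arc, T 0 = S ∧
    (∀ i : Fin n, IsMinimalArc (T i.castSucc) (E i) ∧ T i.succ = perp (T i.castSucc) (E i)) ∧
    T (Fin.last n) = ∅

end Arc

/-! ### Exceptional collections -/

section Exceptional

variable (𝕜 : Type u) [Field 𝕜] {T : Type*} [Category T] [Preadditive T] [HasShift T ℤ]
  [Linear 𝕜 T]

/-- `RHom(E, E) ≅ 𝕜`: the endomorphism algebra of `E` is `𝕜`, and there are no nonzero
morphisms `E ⟶ Σ^m E` for `m ≠ 0`. -/
def IsExceptional (E : T) : Prop :=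
  Nonempty (End E ≃ₐ[𝕜] 𝕜) ∧ ∀ m : ℤ, m ≠ 0 → ∀ f : E ⟶ E⟦m⟧, f = 0

/-- An exceptional collection: exceptional objects with `RHom(E_j, E_i) = 0` for `j > i`. -/
def IsExceptionalCollection {n : ℕ} (E : Fin n → T) : Prop :=
  (∀ i, IsExceptional 𝕜 (E i)) ∧
    ∀ i j, i < j → ∀ m : ℤ, ∀ f : E j ⟶ (E i)⟦m⟧, f = 0

/-- An exceptional collection is strong if `RHom(E_i, E_j)` is concentrated in degree `0` for
`i ≤ j`. -/
def IsStrongExceptionalCollection {n : ℕ} (E : Fin n → T) : Prop :=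
  IsExceptionalCollection 𝕜 E ∧
    ∀ i j, i ≤ j → ∀ m : ℤ, m ≠ 0 → ∀ f : E i ⟶ (E j)⟦m⟧, f = 0

end Exceptional

/-! ### Path algebras -/

/-- The path algebra of a quiver: it has the paths as a basis, and the product of two paths is
their concatenation if the first one ends where the second one starts, and `0` otherwise. -/
def PathAlgebra (𝕜 : Type u) [Field 𝕜] (V : Type) [Quiver.{0} V] : Type u :=
  (Σ x : V × V, Quiver.Path x.1 x.2) →₀ 𝕜

namespace PathAlgebra

variable {𝕜 : Type u} [Field 𝕜] {V : Type} [Quiver.{0} V]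

noncomputable instance : AddCommGroup (PathAlgebra 𝕜 V) :=
  inferInstanceAs (AddCommGroup ((Σ x : V × V, Quiver.Path x.1 x.2) →₀ 𝕜))

noncomputable instance : Module 𝕜 (PathAlgebra 𝕜 V) :=
  inferInstanceAs (Module 𝕜 ((Σ x : V × V, Quiver.Path x.1 x.2) →₀ 𝕜))

/-- The basis element of a path. -/
noncomputable def path (p : Σ x : V × V, Quiver.Path x.1 x.2) : PathAlgebra 𝕜 V :=
  Finsupp.single p 1

open Classical in
/-- The product of two paths. -/
noncomputable def pathMul (p q : Σ x : V × V, Quiver.Path x.1 x.2) : PathAlgebra 𝕜 V :=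
  if h : q.1.1 = p.1.2 then path ⟨(p.1.1, q.1.2), p.2.comp (q.2.cast h rfl)⟩ else 0

/-- The multiplication, extended bilinearly from paths. -/
noncomputable def mulLin : PathAlgebra 𝕜 V →ₗ[𝕜] PathAlgebra 𝕜 V →ₗ[𝕜] PathAlgebra 𝕜 V :=
  Finsupp.linearCombination 𝕜 (fun p => (Finsupp.linearCombination 𝕜 (fun q => pathMul p q) :
    PathAlgebra 𝕜 V →ₗ[𝕜] PathAlgebra 𝕜 V))

theorem mulLin_path (p q : Σ x : V × V, Quiver.Path x.1 x.2) :
    mulLin (path p : PathAlgebra 𝕜 V) (path q) = pathMul p q := by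
  have h : mulLin (path p : PathAlgebra 𝕜 V) =
      (Finsupp.linearCombination 𝕜 (fun q => pathMul p q) :
        PathAlgebra 𝕜 V →ₗ[𝕜] PathAlgebra 𝕜 V) := by
    refine (Finsupp.linearCombination_single 𝕜 _ _).trans (one_smul _ _)
  rw [h]
  exact (Finsupp.linearCombination_single 𝕜 _ _).trans (one_smul _ _)

theorem induction {P : PathAlgebra 𝕜 V → Prop} (h0 : P 0) (ha : ∀ x y, P x → P y → P (x + y))
    (hs : ∀ (c : 𝕜) p, P (c • path p)) (x : PathAlgebra 𝕜 V) : P x := by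
  refine Finsupp.induction_linear (motive := P) x h0 ha fun p c => ?_
  have : (Finsupp.single p c : (Σ x : V × V, Quiver.Path x.1 x.2) →₀ 𝕜) =
      c • Finsupp.single p 1 := by simp
  rw [this]
  exact hs c p

theorem mulLin_assoc (x y z : PathAlgebra 𝕜 V) :
    mulLin (mulLin x y) z = mulLin x (mulLin y z) := by
  induction x using induction with
  | h0 => simp
  | ha x x' hx hx' => simp [hx, hx']
  | hs c p =>
  induction y using induction with
  | h0 => simp
  | ha y y' hy hy' => simp only [map_add, LinearMap.add_apply, hy, hy']
  | hs d q =>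
  induction z using induction with
  | h0 => simp
  | ha z z' hz hz' => simp only [map_add, hz, hz']
  | hs e r =>
  simp only [map_smul, LinearMap.smul_apply, mulLin_path]
  congr 3
  obtain ⟨⟨a, b⟩, p⟩ := p
  obtain ⟨⟨b', c⟩, q⟩ := q
  obtain ⟨⟨c', d⟩, r⟩ := r
  by_cases h1 : b' = b
  · subst h1
    by_cases h2 : c' = c
    · subst h2
      simp [pathMul, mulLin_path, Quiver.Path.comp_assoc]
    · simp [pathMul, mulLin_path, h2]
  · by_cases h2 : c' = c
    · subst h2
      simp [pathMul, mulLin_path, h1]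
    · simp [pathMul, h1, h2]

/-- The sum of the trivial paths. -/
noncomputable def unit [Fintype V] : PathAlgebra 𝕜 V := ∑ v : V, path ⟨(v, v), Quiver.Path.nil⟩

theorem unit_mul [Fintype V] (x : PathAlgebra 𝕜 V) : mulLin unit x = x := by
  classical
  induction x using induction with
  | h0 => simp
  | ha x y hx hy => simp only [map_add, hx, hy]
  | hs c p =>
  obtain ⟨⟨a, b⟩, p⟩ := p
  rw [map_smul, unit, map_sum, LinearMap.sum_apply, Finset.sum_eq_single a]
  · simp [mulLin_path, pathMul]
  · intro v _ hv
    simp [mulLin_path, pathMul, hv.symm]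
  · simp

theorem mul_unit [Fintype V] (x : PathAlgebra 𝕜 V) : mulLin x unit = x := by
  classical
  induction x using induction with
  | h0 => simp
  | ha x y hx hy => simp only [map_add, LinearMap.add_apply, hx, hy]
  | hs c p =>
  obtain ⟨⟨a, b⟩, p⟩ := p
  rw [map_smul, LinearMap.smul_apply, unit, map_sum, Finset.sum_eq_single b]
  · simp [mulLin_path, pathMul]
  · intro v _ hv
    simp [mulLin_path, pathMul, hv]
  · simp

noncomputable instance [Fintype V] : Ring (PathAlgebra 𝕜 V) where
  __ := (inferInstance : AddCommGroup (PathAlgebra 𝕜 V))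
  mul x y := mulLin x y
  one := unit
  left_distrib x y z := map_add (mulLin x) y z
  right_distrib x y z := by
    change mulLin (x + y) z = mulLin x z + mulLin y z
    rw [map_add, LinearMap.add_apply]
  zero_mul x := by
    change mulLin 0 x = 0
    rw [map_zero, LinearMap.zero_apply]
  mul_zero x := map_zero (mulLin x)
  mul_assoc := mulLin_assoc
  one_mul := unit_mul
  mul_one := mul_unit

noncomputable instance [Fintype V] : Algebra 𝕜 (PathAlgebra 𝕜 V) :=
  Algebra.ofModule
    (fun r x y => by
      change mulLin (r • x) y = r • mulLin x y
      rw [map_smul, LinearMap.smul_apply])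
    (fun r x y => map_smul (mulLin x) r y)

end PathAlgebra

/-- The vertices of the linearly oriented quiver `A_r`. -/
def LinearQuiver (r : ℕ) : Type := Fin r

instance (r : ℕ) : Fintype (LinearQuiver r) := inferInstanceAs (Fintype (Fin r))

/-- The linearly oriented quiver `A_r`, with one arrow from the `i`-th to the `(i+1)`-st vertex:
`0 → 1 → ⋯ → r - 1`. -/
instance (r : ℕ) : Quiver.{0} (LinearQuiver r) where
  Hom i j := PLift (Fin.val i + 1 = Fin.val j)

/-! ### Graded modules of arcs -/

section ArcModules

open Polynomial

namespace GrModule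

variable {𝕜 : Type u} [Field 𝕜]

/-! The module of an arc $(a,b)$ is generated in degree $-b$ and is one-dimensional exactly in the
degrees $-t$ with $a<t\le b$. Hence $\operatorname{Hom}(M_{(a,b)},M_{(c,d)})$ is at most a line,
spanned by multiplication by $y^{d-b}$, and vanishes unless $a\le c<b\le d$ (`Arc.hom_eq_zero`,
`Arc.exists_eq_smul_homOfLE`). The free resolution $0\to S(a)\to S(b)\to M_{(a,b)}\to 0$ leaves only
$\operatorname{Ext}^1$ in positive degrees, and that group vanishes unless $c<a\le d<b$
(`Arc.ext_eq_zero`). Both vanishing statements carry over to stalk complexes in the derived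
category.

With these criteria the rest is combinatorics. The two inequalities forbidden in $\mathcal
S\perp(l,m)$ are exactly those that would allow an $\operatorname{Ext}^1$ or a $\operatorname{Hom}$
from a surviving arc back to $(l,m)$; this gives exceptionality. An $\operatorname{Ext}^1$ in the
forward direction would need the later arc to have the smaller source, against the lexicographic
order; this gives strongness.

An arc lies in the perpendicular precisely when both or neither of its endpoints lie in $(l,m]$, so
perpendiculars of saturated sets are saturated (`Arc.IsSaturated.perp`) and the procedure can be
iterated. An arc discarded along with the minimal arc $(l,m)$ has the form $(m,d)$. Then $(l,d)$
survives, and saturation returns $(m,d)$ from $(l,m)$ and $(l,d)$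
(`Arc.IsMinimalArc.mem_of_perp_subset`). By induction the chosen arcs generate $\mathcal S$.

Finally, saturation and minimality force a nonzero morphism between two chosen arcs to join arcs
with the same source (`Arc.IsMinimalArc.src_eq_of_hom`). Grouped by source, the arcs therefore form
disjoint chains. The endomorphism algebra is the incidence algebra of these chains, that is, block
diagonal matrices with triangular blocks, and each block is the path algebra of a linear quiver. -/

theorem monomial_smul_mem (N : GrModule (polyGrading 𝕜)) {i j : ℤ} {x : N.carrier}
    (hx : x ∈ N.deg j) (n : ℕ) (c : 𝕜) (h : n + j = i) : monomial n c • x ∈ N.deg i := by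
  have := SetLike.GradedSMul.smul_mem (A := polyGrading 𝕜) (B := N.deg)
    (monomial_mem_polyGrading n c) hx
  rw [vadd_eq_add, h] at this
  exact this

/-- The homogeneous components of a multiple of a homogeneous element. -/
theorem comp_poly_smul (N : GrModule (polyGrading 𝕜)) {i j : ℤ} {g : N.carrier}
    (hg : g ∈ N.deg j) (s : 𝕜[X]) :
    N.comp i (s • g) =
      if j ≤ i then monomial (i - j).toNat (s.coeff (i - j).toNat) • g else 0 := by
  induction s using Polynomial.induction_on' with
  | add s t hs ht =>
    rw [add_smul, map_add, hs, ht]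
    split_ifs
    · rw [coeff_add, map_add, add_smul]
    · rw [add_zero]
  | monomial n c =>
    have hm := N.monomial_smul_mem hg n c rfl
    by_cases h : i = n + j
    · subst h
      rw [comp_same _ _ hm, if_pos (by omega)]
      simp
    · rw [comp_ne _ h hm]
      split_ifs with hi
      · rw [coeff_monomial_of_ne _ (by omega), map_zero, zero_smul]
      · rfl

end GrModule

/-! ### Generators of arc modules and the morphisms between them. -/

namespace Arc

variable {𝕜 : Type u} [Field 𝕜]

theorem tgt_eq (p : Arc) : p.tgt = (p.tgtInt : WithBot ℤ) := (WithBot.coe_unbot _ _).symm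

theorem src_lt_tgtInt (p : Arc) : p.src < (p.tgtInt : WithBot ℤ) := p.tgt_eq ▸ p.lt

theorem lt_tgtInt {p : Arc} {a : ℤ} (h : p.src = a) : a < p.tgtInt := by
  have := p.src_lt_tgtInt
  rw [h] at this
  exact_mod_cast this

variable (𝕜) in
-- These three properties determine the module of an arc. The definition of the module by cases on
-- the source is unfolded only here; later arguments use the generator and its annihilator.
theorem exists_gen (p : Arc) : ∃ g : (p.module 𝕜).obj.carrier,
    g ∈ (p.module 𝕜).obj.deg (-p.tgtInt) ∧ (∀ x, ∃ s : 𝕜[X], s • g = x) ∧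
      ∀ s : 𝕜[X], s • g = 0 ↔
        s = 0 ∨ ∃ a : ℤ, p.src = a ∧ (X : 𝕜[X]) ^ (p.tgtInt - a).toNat ∣ s := by
  have h1 (j : ℤ) : (1 : 𝕜[X]) ∈ polyGrading 𝕜 (-j + j) := by
    have := monomial_mem_polyGrading 0 (1 : 𝕜)
    simpa using this
  obtain ⟨a, b, hab⟩ := p
  cases a with
  | bot =>
    refine ⟨(1 : 𝕜[X]), h1 _, fun x => ⟨x, mul_one (M := 𝕜[X]) x⟩, fun s => ?_⟩
    have : s • (1 : 𝕜[X]) = 0 ↔ s = 0 := by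
      rw [smul_eq_mul, mul_one]
    refine this.trans ⟨Or.inl, ?_⟩
    rintro (h | ⟨a, ha, -⟩)
    · exact h
    · exact absurd ha WithBot.bot_ne_coe
  | coe a =>
    set n := (tgtInt ⟨a, b, hab⟩ - a).toNat with hn
    refine ⟨(Submodule.Quotient.mk (1 : 𝕜[X]) : 𝕜[X] ⧸ Ideal.span {(X : 𝕜[X]) ^ n}),
      ⟨(1 : 𝕜[X]), h1 _, rfl⟩, fun x => ?_, fun s => ?_⟩
    · obtain ⟨s, rfl⟩ := Submodule.Quotient.mk_surjective _ x
      exact ⟨s, congrArg Submodule.Quotient.mk (mul_one (M := 𝕜[X]) s)⟩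
    · have : s • (Submodule.Quotient.mk (1 : 𝕜[X]) : 𝕜[X] ⧸ Ideal.span {(X : 𝕜[X]) ^ n}) = 0 ↔
          X ^ n ∣ s := by
        rw [← Submodule.Quotient.mk_smul, smul_eq_mul, mul_one, Submodule.Quotient.mk_eq_zero,
          Ideal.mem_span_singleton]
      refine this.trans ⟨fun h => Or.inr ⟨a, rfl, h⟩, ?_⟩
      rintro (rfl | ⟨a', ha, h⟩)
      · exact dvd_zero _
      · obtain rfl : a = a' := WithBot.coe_injective ha
        exact h

variable (𝕜) in
/-- The generator of the module of an arc. -/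
noncomputable def gen (p : Arc) : (p.module 𝕜).obj.carrier := (p.exists_gen 𝕜).choose

theorem gen_mem (p : Arc) : p.gen 𝕜 ∈ (p.module 𝕜).obj.deg (-p.tgtInt) :=
  (p.exists_gen 𝕜).choose_spec.1

theorem exists_smul_gen (p : Arc) (x : (p.module 𝕜).obj.carrier) : ∃ s : 𝕜[X], s • p.gen 𝕜 = x :=
  (p.exists_gen 𝕜).choose_spec.2.1 x

theorem smul_gen_eq_zero_iff (p : Arc) (s : 𝕜[X]) : s • p.gen 𝕜 = 0 ↔
    s = 0 ∨ ∃ a : ℤ, p.src = a ∧ (X : 𝕜[X]) ^ (p.tgtInt - a).toNat ∣ s :=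
  (p.exists_gen 𝕜).choose_spec.2.2 s

/-- The multiple of the generator by $y^n$ has degree $-(b-n)$, and the module lives in the degrees
$-t$ with $a<t\le b$. For source $-\infty$ the inequality never holds, as it should for a free
module. -/
theorem monomial_smul_gen_eq_zero_iff (p : Arc) (n : ℕ) (c : 𝕜) :
    monomial n c • p.gen 𝕜 = 0 ↔ c = 0 ∨ ((p.tgtInt - n : ℤ) : WithBot ℤ) ≤ p.src := by
  rw [smul_gen_eq_zero_iff, monomial_eq_zero_iff]
  by_cases hc : c = 0
  · simp [hc]
  simp only [hc, false_or]
  obtain ⟨a, b, hab⟩ := p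
  cases a with
  | bot =>
    simp
  | coe a =>
    simp only [WithBot.coe_inj, exists_eq_left', WithBot.coe_le_coe]
    constructor
    · intro h
      have := (X_pow_dvd_iff.1 h) n
      rw [coeff_monomial_same] at this
      by_contra hlt
      exact hc (this (by omega))
    · intro h
      rw [X_pow_dvd_iff]
      intro d hd
      exact coeff_monomial_of_ne c (by omega)

theorem eq_monomial_smul_gen (p : Arc) {i : ℤ} {x : (p.module 𝕜).obj.carrier}
    (hx : x ∈ (p.module 𝕜).obj.deg i) (h0 : x ≠ 0) :
    -i ≤ p.tgtInt ∧ p.src < ((-i : ℤ) : WithBot ℤ) ∧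
      ∃ c : 𝕜, x = monomial (i + p.tgtInt).toNat c • p.gen 𝕜 := by
  obtain ⟨s, rfl⟩ := p.exists_smul_gen x
  have h := GrModule.comp_poly_smul (i := i) _ p.gen_mem s
  rw [GrModule.comp_same _ _ hx, sub_neg_eq_add] at h
  split_ifs at h with hi
  · refine ⟨by omega, ?_, _, h⟩
    by_contra hs
    refine h0 (h.trans ((p.monomial_smul_gen_eq_zero_iff _ _).2 (Or.inr ?_)))
    have : p.tgtInt - (i + p.tgtInt).toNat = -i := by omega
    rw [this]
    exact not_lt.1 hs
  · exact absurd h h0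

/-- Morphisms from the module of an arc are given by elements annihilated by the relation. -/
theorem exists_hom (p : Arc) {N : GrS 𝕜} {z : N.obj.carrier} (hz : z ∈ N.obj.deg (-p.tgtInt))
    (h : ∀ a : ℤ, p.src = a → (X : 𝕜[X]) ^ (p.tgtInt - a).toNat • z = 0) :
    ∃ f : p.module 𝕜 ⟶ N, GrModule.lin f.hom (p.gen 𝕜) = z := by
  have hker : ∀ s : 𝕜[X], s • p.gen 𝕜 = 0 → s • z = 0 := by
    intro s hs
    rcases (p.smul_gen_eq_zero_iff s).1 hs with rfl | ⟨a, ha, t, rfl⟩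
    · exact zero_smul _ _
    · rw [mul_comm, mul_smul, h a ha, smul_zero]
  -- `σ` picks an arbitrary coefficient for each element. Two coefficients of the same element
  -- differ by an annihilator of the generator, which kills `z` by `hker`, so the map does not
  -- depend on the choice.
  choose σ hσ using fun x => p.exists_smul_gen (𝕜 := 𝕜) x
  have hwd : ∀ (s : 𝕜[X]) x, s • p.gen 𝕜 = x → σ x • z = s • z := by
    rintro s x rfl
    rw [← sub_eq_zero, ← sub_smul]
    apply hker
    rw [sub_smul, hσ, sub_self]
  let f : (p.module 𝕜).obj.carrier →ₗ[𝕜[X]] N.obj.carrier :=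
    { toFun := fun x => σ x • z
      map_add' := fun x y => by
        rw [hwd (σ x + σ y) (x + y) (by rw [add_smul, hσ, hσ]), add_smul]
      map_smul' := fun s x => by
        rw [hwd (s * σ x) (s • x) (by rw [mul_smul, hσ]), mul_smul]
        rfl }
  have hf : ∀ s : 𝕜[X], f (s • p.gen 𝕜) = s • z := fun s => hwd s _ rfl
  refine ⟨ObjectProperty.homMk (GrModule.mkHom f fun i x hx => ?_), ?_⟩
  · by_cases h0 : x = 0
    · rw [h0, map_zero]
      exact zero_mem _
    obtain ⟨hi, -, c, rfl⟩ := p.eq_monomial_smul_gen hx h0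
    rw [hf]
    exact GrModule.monomial_smul_mem _ hz _ _ (by omega)
  · exact (congrArg f (one_smul 𝕜[X] (p.gen 𝕜))).symm.trans ((hf 1).trans (one_smul _ _))

theorem hom_ext_gen (p : Arc) {N : GrS 𝕜} {f g : p.module 𝕜 ⟶ N}
    (h : GrModule.lin f.hom (p.gen 𝕜) = GrModule.lin g.hom (p.gen 𝕜)) : f = g := by
  apply ObjectProperty.hom_ext
  apply GrModule.hom_ext
  ext x
  obtain ⟨s, rfl⟩ := p.exists_smul_gen x
  rw [map_smul, map_smul, h]

/-- Nonzero morphisms between the modules of arcs `(a, b)` and `(c, d)` exist only if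
`a ≤ c < b ≤ d`. -/
theorem hom_eq_zero {p q : Arc} (h : ¬ (p.src ≤ q.src ∧ q.src < p.tgt ∧ p.tgt ≤ q.tgt))
    (f : p.module 𝕜 ⟶ q.module 𝕜) : f = 0 := by
  by_contra hf
  apply h
  have hz := GrModule.lin_mem f.hom (p.gen_mem (𝕜 := 𝕜))
  have h0 : GrModule.lin f.hom (p.gen 𝕜) ≠ 0 := fun h0 => hf (p.hom_ext_gen h0)
  obtain ⟨h1, h2, c, h3⟩ := q.eq_monomial_smul_gen hz h0
  rw [neg_neg] at h1 h2
  rw [p.tgt_eq, q.tgt_eq]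
  refine ⟨?_, h2, by exact_mod_cast h1⟩
  obtain ⟨a, b, hab⟩ := p
  cases a with
  | bot => exact bot_le
  | coe a =>
    have hab' : a < tgtInt ⟨a, b, hab⟩ := lt_tgtInt rfl
    -- The relation $y^{b-a}g=0$ must hold for the image of the generator as well. That image is a
    -- nonzero multiple of $y^{d-b}$ times the generator of the target, so the product vanishes only
    -- if $d-(d-b)-(b-a)=a\le c$.
    have hr : (X : 𝕜[X]) ^ (tgtInt ⟨a, b, hab⟩ - a).toNat • gen 𝕜 ⟨a, b, hab⟩ = 0 :=
      (smul_gen_eq_zero_iff _ _).2 (Or.inr ⟨a, rfl, dvd_rfl⟩)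
    have hr' := congrArg (GrModule.lin f.hom) hr
    rw [map_smul, map_zero, h3, ← mul_smul, ← monomial_one_right_eq_X_pow, monomial_mul_monomial,
      one_mul, monomial_smul_gen_eq_zero_iff] at hr'
    rcases hr' with hc | hr'
    · rw [h3, hc, map_zero, zero_smul] at h0
      exact absurd rfl h0
    · convert hr' using 2
      omega

theorem exists_homOfLE {p q : Arc} (hs : p.src ≤ q.src) (ht : p.tgt ≤ q.tgt) :
    ∃ f : p.module 𝕜 ⟶ q.module 𝕜,
      GrModule.lin f.hom (p.gen 𝕜) = monomial (q.tgtInt - p.tgtInt).toNat (1 : 𝕜) • q.gen 𝕜 := by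
  have ht' : p.tgtInt ≤ q.tgtInt := by
    rw [p.tgt_eq, q.tgt_eq] at ht
    exact_mod_cast ht
  refine p.exists_hom (GrModule.monomial_smul_mem _ q.gen_mem _ _ (by omega)) fun a ha => ?_
  have := lt_tgtInt ha
  rw [← mul_smul, ← monomial_one_right_eq_X_pow, monomial_mul_monomial, one_mul,
    monomial_smul_gen_eq_zero_iff]
  refine Or.inr (le_trans (le_of_eq ?_) (ha ▸ hs))
  congr 1
  omega

variable (𝕜) in
/-- The morphism `M_(a,b) ⟶ M_(c,d)` given by multiplication by `y^(d-b)`, for `a ≤ c` and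
`b ≤ d`. -/
noncomputable def homOfLE {p q : Arc} (hs : p.src ≤ q.src) (ht : p.tgt ≤ q.tgt) :
    p.module 𝕜 ⟶ q.module 𝕜 := (exists_homOfLE hs ht).choose

theorem homOfLE_gen {p q : Arc} (hs : p.src ≤ q.src) (ht : p.tgt ≤ q.tgt) :
    GrModule.lin (homOfLE 𝕜 hs ht).hom (p.gen 𝕜) =
      monomial (q.tgtInt - p.tgtInt).toNat (1 : 𝕜) • q.gen 𝕜 :=
  (exists_homOfLE hs ht).choose_spec

theorem tgtInt_le {p q : Arc} (ht : p.tgt ≤ q.tgt) : p.tgtInt ≤ q.tgtInt := by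
  rw [p.tgt_eq, q.tgt_eq] at ht
  exact_mod_cast ht

theorem homOfLE_refl (p : Arc) : homOfLE 𝕜 (le_refl p.src) (le_refl p.tgt) = 𝟙 _ := by
  apply p.hom_ext_gen
  rw [homOfLE_gen, sub_self, Int.toNat_zero, monomial_zero_one, one_smul]
  rfl

theorem homOfLE_comp {p q r : Arc} (hs : p.src ≤ q.src) (ht : p.tgt ≤ q.tgt)
    (hs' : q.src ≤ r.src) (ht' : q.tgt ≤ r.tgt) :
    homOfLE 𝕜 hs ht ≫ homOfLE 𝕜 hs' ht' = homOfLE 𝕜 (hs.trans hs') (ht.trans ht') := by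
  apply p.hom_ext_gen
  rw [ObjectProperty.FullSubcategory.comp_hom, GrModule.lin_comp, LinearMap.comp_apply, homOfLE_gen,
    map_smul, homOfLE_gen, homOfLE_gen, ← mul_smul, monomial_mul_monomial, one_mul]
  congr 3
  have := tgtInt_le ht
  have := tgtInt_le ht'
  omega

/-- A morphism is determined by the image of the generator, and the component of the target in the
degree of that generator is at most one-dimensional. -/
theorem exists_eq_smul_homOfLE {p q : Arc} (hs : p.src ≤ q.src) (ht : p.tgt ≤ q.tgt)
    (f : p.module 𝕜 ⟶ q.module 𝕜) : ∃ c : 𝕜, f = c • homOfLE 𝕜 hs ht := by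
  by_cases h0 : GrModule.lin f.hom (p.gen 𝕜) = 0
  · exact ⟨0, p.hom_ext_gen (by rw [h0, zero_smul]; rfl)⟩
  obtain ⟨-, -, c, h⟩ := q.eq_monomial_smul_gen (GrModule.lin_mem f.hom p.gen_mem) h0
  refine ⟨c, p.hom_ext_gen ?_⟩
  have h2 : GrModule.lin (c • homOfLE 𝕜 hs ht).hom (p.gen 𝕜) =
      (algebraMap 𝕜 𝕜[X] c) • GrModule.lin (homOfLE 𝕜 hs ht).hom (p.gen 𝕜) := rfl
  rw [h, h2, homOfLE_gen, ← mul_smul, ← C_eq_algebraMap, C_mul_monomial, mul_one]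
  congr 3
  omega

theorem homOfLE_ne_zero {p q : Arc} (hs : p.src ≤ q.src) (ht : p.tgt ≤ q.tgt)
    (h : q.src < p.tgt) : homOfLE 𝕜 hs ht ≠ 0 := by
  intro h0
  have h1 := homOfLE_gen (𝕜 := 𝕜) hs ht
  rw [h0] at h1
  rcases (monomial_smul_gen_eq_zero_iff _ _ _).1 h1.symm with h2 | h2
  · exact one_ne_zero h2
  · have := tgtInt_le ht
    have e : q.tgtInt - (q.tgtInt - p.tgtInt).toNat = p.tgtInt := by omega
    rw [e, ← p.tgt_eq] at h2
    exact absurd h (not_lt.2 h2)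

end Arc

end ArcModules

/-! ### Morphisms in the derived category -/

section GrS

open Polynomial Abelian

variable {𝕜 : Type u} [Field 𝕜]

/-- An epimorphism of the full subcategory is not a priori one among all graded modules. The
cokernel, however, is a quotient of a finitely generated module, so it lies in the subcategory and
the projection onto it can be tested there. -/
theorem GrS.surjective_of_epi {M N : GrS 𝕜} (f : M ⟶ N) [Epi f] :
    Function.Surjective (GrModule.lin f.hom) := by
  let Q : GrS 𝕜 := ⟨GrModule.coker f.hom,
    by
      have hN := N.property
      rw [GrModule.isFP_iff] at hN ⊢
      exact Module.Finite.of_surjective (GrModule.lin (GrModule.cokerπ f.hom))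
        (GrModule.cokerπ_surjective f.hom)⟩
  let π : N ⟶ Q := ObjectProperty.homMk (GrModule.cokerπ f.hom)
  have h : π = 0 := by
    rw [← cancel_epi f, Limits.comp_zero]
    exact ObjectProperty.hom_ext _ (GrModule.comp_cokerπ f.hom)
  intro y
  exact GrModule.cokerπ_eq_zero f.hom (congrArg (fun k => GrModule.lin k.hom y) h)

/-- Exactness can be checked on elements: the kernel property holds among all graded modules, and it
restricts to the subcategory because that subcategory is full. -/
theorem GrS.shortExact_of_exact {S : ShortComplex (GrS 𝕜)}
    (hf : Function.Injective (GrModule.lin S.f.hom))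
    (hg : Function.Surjective (GrModule.lin S.g.hom))
    (he : ∀ y, GrModule.lin S.g.hom y = 0 → ∃ x, GrModule.lin S.f.hom x = y) : S.ShortExact := by
  have w : S.f.hom ≫ S.g.hom = 0 := congrArg (fun k => k.hom) S.zero
  have hl := GrModule.isLimitOfExact S.f.hom S.g.hom w hf he
  have hm : Mono S.f := ⟨fun u v huv => ObjectProperty.hom_ext _ (GrModule.hom_ext
    (LinearMap.ext fun x => hf (congrArg (fun k => GrModule.lin k.hom x) huv)))⟩
  have hepi : Epi S.g := ⟨fun u v huv => ObjectProperty.hom_ext _ (GrModule.hom_ext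
    (LinearMap.ext fun y => by
      obtain ⟨x, rfl⟩ := hg y
      exact congrArg (fun k => GrModule.lin k.hom x) huv))⟩
  refine { exact := S.exact_of_f_is_kernel (KernelFork.IsLimit.ofι' _ _ fun {A} k hk => ?_) }
  have hk' : k.hom ≫ S.g.hom = 0 := congrArg (fun k => k.hom) hk
  exact ⟨ObjectProperty.homMk (hl.lift (KernelFork.ofι k.hom hk')),
    ObjectProperty.hom_ext _ (hl.fac (KernelFork.ofι k.hom hk') WalkingParallelPair.zero)⟩

/-! ### Free resolutions of arc modules and vanishing of Ext. -/

namespace Arc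

theorem projective_module {p : Arc} (h : p.src = ⊥) : Projective (p.module 𝕜) where
  factors {E X} f e he := by
    obtain ⟨y, hy⟩ := GrS.surjective_of_epi e (GrModule.lin f.hom (p.gen 𝕜))
    obtain ⟨g, hg⟩ := p.exists_hom (GrModule.comp_mem E.obj (-p.tgtInt) y)
      (fun a ha => absurd (h.symm.trans ha) WithBot.bot_ne_coe)
    refine ⟨g, p.hom_ext_gen ?_⟩
    rw [ObjectProperty.FullSubcategory.comp_hom, GrModule.lin_comp, LinearMap.comp_apply, hg,
      GrModule.lin_component, hy, GrModule.comp_same _ _ (GrModule.lin_mem f.hom p.gen_mem)]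

variable (𝕜) in
/-- The short complex `M_(c,d) ⟶ M_(c,b) ⟶ M_(d,b)`. -/
noncomputable def shortComplex {p q r : Arc} (h₁ : p.src = q.src) (h₂ : p.tgt = r.src)
    (h₃ : q.tgt = r.tgt) : ShortComplex (GrS 𝕜) where
  f := homOfLE 𝕜 h₁.le ((h₂.le.trans r.lt.le).trans h₃.ge)
  g := homOfLE 𝕜 (h₁.ge.trans (p.lt.le.trans h₂.le)) h₃.le
  zero := by
    rw [homOfLE_comp]
    exact hom_eq_zero (fun h => absurd h₂.symm h.2.1.ne) _

/-- This is the free resolution $0\to S(a)\to S(b)\to M_{(a,b)}\to 0$. On generators the maps are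
multiplication by $y^{b-a}$ and the projection; the first is injective since $\mathbb k[y]$ is a
domain. -/
theorem shortExact_of_bot {p q r : Arc} (hp : p.src = ⊥) (hq : q.src = ⊥) (h₂ : p.tgt = r.src)
    (h₃ : q.tgt = r.tgt) : (shortComplex 𝕜 (hp.trans hq.symm) h₂ h₃).ShortExact := by
  have hqr : q.tgtInt = r.tgtInt :=
    le_antisymm (tgtInt_le h₃.le) (tgtInt_le h₃.ge)
  have hpq := tgtInt_le ((h₂.le.trans r.lt.le).trans h₃.ge)
  have hr : r.src = (p.tgtInt : WithBot ℤ) := h₂.symm.trans p.tgt_eq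
  have hbot : ∀ {p : Arc}, p.src = ⊥ → ∀ s : 𝕜[X], s • p.gen 𝕜 = 0 → s = 0 := by
    intro p hp s hs
    rcases (smul_gen_eq_zero_iff _ _).1 hs with h | ⟨a, ha, -⟩
    · exact h
    · exact absurd (hp.symm.trans ha) WithBot.bot_ne_coe
  have hf : ∀ s : 𝕜[X], GrModule.lin
      (homOfLE 𝕜 (hp.trans hq.symm).le ((h₂.le.trans r.lt.le).trans h₃.ge)).hom (s • p.gen 𝕜) = (X ^ (q.tgtInt - p.tgtInt).toNat * s) • q.gen 𝕜 := by
    intro s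
    rw [map_smul, homOfLE_gen, ← mul_smul, monomial_one_right_eq_X_pow, mul_comm]
  have hg : ∀ s : 𝕜[X], GrModule.lin
      (homOfLE 𝕜 ((hp.trans hq.symm).ge.trans (p.lt.le.trans h₂.le)) h₃.le).hom (s • q.gen 𝕜) = s • r.gen 𝕜 := by
    intro s
    rw [map_smul, homOfLE_gen, hqr, sub_self, Int.toNat_zero, monomial_zero_one, one_smul]
  refine GrS.shortExact_of_exact ((injective_iff_map_eq_zero _).2 fun x hx => ?_) (fun y => ?_)
    fun y hy => ?_
  · obtain ⟨s, rfl⟩ := p.exists_smul_gen x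
    rcases mul_eq_zero.1 (hbot hq _ ((hf s).symm.trans hx)) with h | h
    · exact absurd h (pow_ne_zero _ X_ne_zero)
    · exact (congrArg (· • p.gen 𝕜) h).trans (zero_smul _ _)
  · obtain ⟨s, rfl⟩ := r.exists_smul_gen y
    exact ⟨s • q.gen 𝕜, hg s⟩
  · obtain ⟨s, rfl⟩ := q.exists_smul_gen y
    rcases (r.smul_gen_eq_zero_iff s).1 ((hg s).symm.trans hy) with rfl | ⟨a, ha, t, rfl⟩
    · exact ⟨0, (map_zero _).trans (zero_smul _ _).symm⟩
    · obtain rfl : p.tgtInt = a := WithBot.coe_injective (hr.symm.trans ha)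
      exact ⟨t • p.gen 𝕜, (hf t).trans (by rw [hqr])⟩

/-- Extending every morphism over the inclusion of free modules is what makes $\operatorname{Ext}^1$
of the cokernel vanish. A nonzero morphism to $M_{(c,d)}$ is a multiple of a power of $y$, and it
extends as soon as $d$ is at least the target of the larger free module; the hypothesis excludes any
other nonzero case. -/
theorem exists_factorization {p q r : Arc} (hp : p.src = ⊥) (hq : q.src = ⊥)
    (hpq : p.tgt ≤ q.tgt) (h : ¬ (r.src < p.tgt ∧ p.tgt ≤ r.tgt ∧ r.tgt < q.tgt))
    (f : p.module 𝕜 ⟶ r.module 𝕜) :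
    ∃ g : q.module 𝕜 ⟶ r.module 𝕜, homOfLE 𝕜 (hp.trans hq.symm).le hpq ≫ g = f := by
  by_cases hf : p.src ≤ r.src ∧ r.src < p.tgt ∧ p.tgt ≤ r.tgt
  · obtain ⟨h1, h2, h3⟩ := hf
    obtain ⟨c, rfl⟩ := exists_eq_smul_homOfLE h1 h3 f
    have h4 : q.tgt ≤ r.tgt := not_lt.1 fun h4 => h ⟨h2, h3, h4⟩
    refine ⟨c • homOfLE 𝕜 (hq.trans_le bot_le) h4, ?_⟩
    rw [Linear.comp_smul, homOfLE_comp]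
  · exact ⟨0, by rw [Limits.comp_zero, hom_eq_zero hf f]⟩

theorem ext_eq_zero [HasExt.{u+1} (GrS 𝕜)] {p q : Arc}
    (h : ¬ (q.src < p.src ∧ p.src ≤ q.tgt ∧ q.tgt < p.tgt)) {n : ℕ} (hn : n ≠ 0)
    (x : Ext (p.module 𝕜) (q.module 𝕜) n) : x = 0 := by
  obtain ⟨n, rfl⟩ := Nat.exists_eq_succ_of_ne_zero hn
  -- The free case is separate because the first term of the resolution, from $-\infty$ to the
  -- source of `p`, must be an arc.
  by_cases hp : p.src = ⊥
  · have := projective_module (𝕜 := 𝕜) hp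
    exact Ext.eq_zero_of_projective x
  let p₁ : Arc := ⟨⊥, p.src, bot_lt_iff_ne_bot.2 hp⟩
  let p₂ : Arc := ⟨⊥, p.tgt, bot_le.trans_lt p.lt⟩
  have hS := shortExact_of_bot (𝕜 := 𝕜) (p := p₁) (q := p₂) (r := p) rfl rfl rfl rfl
  have : Projective (shortComplex 𝕜 (p := p₁) (q := p₂) (r := p) rfl rfl rfl).X₁ :=
    projective_module (𝕜 := 𝕜) (p := p₁) rfl
  have : Projective (shortComplex 𝕜 (p := p₁) (q := p₂) (r := p) rfl rfl rfl).X₂ :=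
    projective_module (𝕜 := 𝕜) (p := p₂) rfl
  -- As the middle term is projective, every class comes from `y` by the connecting map. In positive
  -- degree `y` vanishes because the first term is projective too. In degree zero `y` is a morphism
  -- that extends over the middle term, so the connecting map kills it.
  obtain ⟨y, rfl⟩ := Ext.contravariant_sequence_exact₃ hS (q.module 𝕜) x
    (Ext.eq_zero_of_projective _) (add_comm 1 n)
  cases n with
  | succ n => exact (congrArg (fun z => hS.extClass.comp z _)
      (Ext.eq_zero_of_projective y)).trans (Ext.comp_zero _ _ _ _ _)
  | zero =>
    obtain ⟨f, rfl⟩ := (Ext.mk₀_bijective _ _).2 y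
    obtain ⟨g, rfl⟩ := exists_factorization (p := p₁) (q := p₂) rfl rfl p.lt.le h f
    have e : (Ext.mk₀ (homOfLE 𝕜 (p := p₁) (q := p₂) le_rfl p.lt.le ≫ g)) =
        (Ext.mk₀ (shortComplex 𝕜 (p := p₁) (q := p₂) (r := p) rfl rfl rfl).f).comp (Ext.mk₀ g)
          (zero_add 0) := (Ext.mk₀_comp_mk₀ _ _).symm
    refine (congrArg (fun z => hS.extClass.comp z _) e).trans ?_
    refine (Ext.comp_assoc_of_second_deg_zero _ _ _ _).symm.trans ?_
    exact (congrArg (fun z => Ext.comp z _ _) hS.extClass_comp).trans (Ext.zero_comp _ _ _ _ _)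

end Arc

/-- The embedding of `gr S` into `D^b(gr S)`. -/
noncomputable def stalkFunctor (𝕜 : Type u) [Field 𝕜] : GrS 𝕜 ⥤ DbGrS 𝕜 :=
  ObjectProperty.lift _ (DerivedCategory.singleFunctor (GrS 𝕜) 0) fun M => (stalk 𝕜 M).property

noncomputable instance : (stalkFunctor 𝕜).Additive where
  map_add {_ _ f g} := ObjectProperty.hom_ext _
    ((DerivedCategory.singleFunctor (GrS 𝕜) 0).map_add (f := f) (g := g))

noncomputable instance : (stalkFunctor 𝕜).Linear 𝕜 where
  map_smul f c := ObjectProperty.hom_ext _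
    ((DerivedCategory.singleFunctor (GrS 𝕜) 0).map_smul c f)

instance : (stalkFunctor 𝕜).Full where
  map_surjective f := by
    obtain ⟨g, hg⟩ := (DerivedCategory.singleFunctor (GrS 𝕜) 0).map_surjective f.hom
    exact ⟨g, ObjectProperty.hom_ext _ hg⟩

instance : (stalkFunctor 𝕜).Faithful where
  map_injective h := (DerivedCategory.singleFunctor (GrS 𝕜) 0).map_injective
    (congrArg (fun k => k.hom) h)

/-! ### Morphisms between stalk complexes of arcs. -/

namespace Arc

theorem shiftedHom_single_eq_zero {p q : Arc}
    (h : ¬ (q.src < p.src ∧ p.src ≤ q.tgt ∧ q.tgt < p.tgt)) {m : ℤ} (hm : m ≠ 0)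
    (f : (DerivedCategory.singleFunctor (GrS 𝕜) 0).obj (p.module 𝕜) ⟶
      ((DerivedCategory.singleFunctor (GrS 𝕜) 0).obj (q.module 𝕜))⟦m⟧) : f = 0 := by
  rcases lt_or_ge m 0 with hneg | hpos
  -- For negative `m` the shifted target lives in degrees at least $-m>0$ while the source lives in
  -- degree $0$, so the t-structure leaves no morphisms.
  · have := DerivedCategory.TStructure.t.isGE_shift
      ((DerivedCategory.singleFunctor (GrS 𝕜) 0).obj (q.module 𝕜)) 0 m (-m)
    exact DerivedCategory.TStructure.t.zero f 0 (-m) (by omega)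
  · have : HasExt.{u+1} (GrS 𝕜) := hasExt_of_hasDerivedCategory _
    obtain ⟨n, rfl⟩ := Int.eq_ofNat_of_zero_le hpos
    obtain ⟨x, rfl⟩ := (Ext.homEquiv (X := p.module 𝕜) (Y := q.module 𝕜) (n := n)).surjective f
    rw [ext_eq_zero h (by exact_mod_cast hm) x]
    exact Ext.zero_hom _ _ _

theorem shiftedHom_eq_zero {p q : Arc}
    (h : ¬ (q.src < p.src ∧ p.src ≤ q.tgt ∧ q.tgt < p.tgt)) {m : ℤ} (hm : m ≠ 0)
    (f : p.obj 𝕜 ⟶ (q.obj 𝕜)⟦m⟧) : f = 0 := by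
  let e := ((DerivedCategory.Bounded.ι (C := GrS 𝕜)).commShiftIso m).app (q.obj 𝕜)
  have h0 : f.hom ≫ e.hom = 0 := shiftedHom_single_eq_zero h hm _
  apply ObjectProperty.hom_ext
  exact (cancel_mono e.hom).1 (h0.trans zero_comp.symm)

theorem obj_hom_eq_zero {p q : Arc} (h : ¬ (p.src ≤ q.src ∧ q.src < p.tgt ∧ p.tgt ≤ q.tgt))
    (f : p.obj 𝕜 ⟶ q.obj 𝕜) : f = 0 := by
  obtain ⟨g, rfl⟩ := (stalkFunctor 𝕜).map_surjective (X := p.module 𝕜) (Y := q.module 𝕜) f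
  rw [hom_eq_zero h g]
  exact (stalkFunctor 𝕜).map_zero _ _

variable (𝕜) in
/-- The image of `homOfLE` in `D^b(gr S)`. -/
noncomputable def objHomOfLE {p q : Arc} (hs : p.src ≤ q.src) (ht : p.tgt ≤ q.tgt) :
    p.obj 𝕜 ⟶ q.obj 𝕜 := (stalkFunctor 𝕜).map (homOfLE 𝕜 hs ht)

theorem objHomOfLE_refl (p : Arc) : objHomOfLE 𝕜 (le_refl p.src) (le_refl p.tgt) = 𝟙 _ :=
  (congrArg (stalkFunctor 𝕜).map (homOfLE_refl p)).trans ((stalkFunctor 𝕜).map_id _)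

theorem objHomOfLE_comp {p q r : Arc} (hs : p.src ≤ q.src) (ht : p.tgt ≤ q.tgt)
    (hs' : q.src ≤ r.src) (ht' : q.tgt ≤ r.tgt) :
    objHomOfLE 𝕜 hs ht ≫ objHomOfLE 𝕜 hs' ht' = objHomOfLE 𝕜 (hs.trans hs') (ht.trans ht') :=
  ((stalkFunctor 𝕜).map_comp _ _).symm.trans
    (congrArg (stalkFunctor 𝕜).map (homOfLE_comp hs ht hs' ht'))

theorem exists_eq_smul_objHomOfLE {p q : Arc} (hs : p.src ≤ q.src) (ht : p.tgt ≤ q.tgt)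
    (f : p.obj 𝕜 ⟶ q.obj 𝕜) : ∃ c : 𝕜, f = c • objHomOfLE 𝕜 hs ht := by
  obtain ⟨g, rfl⟩ := (stalkFunctor 𝕜).map_surjective (X := p.module 𝕜) (Y := q.module 𝕜) f
  obtain ⟨c, rfl⟩ := exists_eq_smul_homOfLE hs ht g
  exact ⟨c, (stalkFunctor 𝕜).map_smul c _⟩

theorem objHomOfLE_ne_zero {p q : Arc} (hs : p.src ≤ q.src) (ht : p.tgt ≤ q.tgt)
    (h : q.src < p.tgt) : objHomOfLE 𝕜 hs ht ≠ 0 := fun h0 =>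
  homOfLE_ne_zero hs ht h
    ((stalkFunctor 𝕜).map_injective (h0.trans ((stalkFunctor 𝕜).map_zero _ _).symm))

theorem isExceptional_obj (p : Arc) : IsExceptional 𝕜 (p.obj 𝕜) := by
  refine ⟨⟨(AlgEquiv.ofBijective (Algebra.ofId 𝕜 (End (p.obj 𝕜))) ⟨?_, ?_⟩).symm⟩,
    fun m hm f => shiftedHom_eq_zero (fun h => lt_irrefl _ h.1) hm f⟩
  · have : Nontrivial (End (p.obj 𝕜)) := ⟨⟨1, 0, fun h =>
      objHomOfLE_ne_zero (le_refl p.src) (le_refl p.tgt) p.lt ((objHomOfLE_refl p).trans h)⟩⟩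
    exact (algebraMap 𝕜 (End (p.obj 𝕜))).injective
  · intro f
    obtain ⟨c, rfl⟩ := exists_eq_smul_objHomOfLE (le_refl p.src) (le_refl p.tgt) f
    exact ⟨c, (Algebra.algebraMap_eq_smul_one c).trans
      (congrArg (c • ·) (objHomOfLE_refl p).symm)⟩

end Arc

end GrS

/-! ### Combinatorics of saturated sets of arcs -/

namespace Arc

theorem isSaturated_sat (U : Set Arc) : IsSaturated (sat U) := by
  intro p hp q hq h1 h2 h3
  refine ⟨fun h T hT => ?_, fun h T hT => ?_, fun h T hT => ?_, fun h T hT => ?_⟩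
  · exact (hT.1 p (hp T hT) q (hq T hT) h1 h2 h3).1 h
  · exact (hT.1 p (hp T hT) q (hq T hT) h1 h2 h3).2.1 h
  · exact (hT.1 p (hp T hT) q (hq T hT) h1 h2 h3).2.2.1 h
  · exact (hT.1 p (hp T hT) q (hq T hT) h1 h2 h3).2.2.2 h

theorem subset_sat (U : Set Arc) : U ⊆ sat U := fun _ hp _ hT => hT.2 hp

theorem sat_subset {U T : Set Arc} (hT : IsSaturated T) (h : U ⊆ T) : sat U ⊆ T :=
  fun _ hp => hp T ⟨hT, h⟩

/-- Saturation creates no new endpoints, and only finitely many arcs have their endpoints in a given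
finite set. -/
theorem finite_sat {F : Set Arc} (hF : F.Finite) : (sat F).Finite := by
  set V : Set (WithBot ℤ) := src '' F ∪ tgt '' F with hV
  have hVf : V.Finite := (hF.image _).union (hF.image _)
  have hfin : {p : Arc | p.src ∈ V ∧ p.tgt ∈ V}.Finite := by
    refine Set.Finite.of_finite_image (f := fun p => (p.src, p.tgt))
      ((hVf.prod hVf).subset ?_) ?_
    · rintro _ ⟨p, hp, rfl⟩
      exact hp
    · intro p _ q _ h
      exact Arc.ext (congrArg Prod.fst h) (congrArg Prod.snd h)
  refine hfin.subset (sat_subset ?_ ?_)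
  · intro p hp q hq _ _ _
    exact ⟨fun _ => ⟨hp.1, hq.1⟩, fun _ => ⟨hq.1, hp.2⟩, fun _ => ⟨hp.2, hq.2⟩,
      fun _ => ⟨hp.1, hq.2⟩⟩
  · intro p hp
    exact ⟨Or.inl ⟨p, hp, rfl⟩, Or.inr ⟨p, hp, rfl⟩⟩

/-- The two forbidden configurations say that exactly one endpoint lies in the half-open interval
$(l,m]$. In this form stability under saturation becomes visible. -/
theorem mem_perp_iff {S : Set Arc} {p q : Arc} : q ∈ perp S p ↔
    q ∈ S ∧ ((p.src < q.src ∧ q.src ≤ p.tgt) ↔ (p.src < q.tgt ∧ q.tgt ≤ p.tgt)) := by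
  have hq := q.lt
  refine and_congr_right fun _ => ?_
  refine ⟨fun h => ⟨fun h' => ⟨h'.1.trans hq, ?_⟩, fun h' => ⟨?_, hq.le.trans h'.2⟩⟩,
    fun h => ⟨fun h' => ?_, fun h' => ?_⟩⟩
  · exact not_lt.1 fun hlt => h.1 ⟨h'.1, h'.2, hlt⟩
  · exact not_le.1 fun hle => h.2 ⟨hle, h'⟩
  · exact absurd (h.1 ⟨h'.1, h'.2.1⟩).2 (not_le_of_gt h'.2.2)
  · exact absurd (h.2 h'.2).1 (not_lt_of_ge h'.1)

theorem perp_subset (S : Set Arc) (p : Arc) : perp S p ⊆ S := fun _ h => h.1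

theorem notMem_perp (S : Set Arc) (p : Arc) : p ∉ perp S p := fun h =>
  h.2.2 ⟨le_rfl, p.lt, le_rfl⟩

theorem IsSaturated.perp {S : Set Arc} (hS : IsSaturated S) (p : Arc) :
    IsSaturated (perp S p) := by
  intro q hq r hr h1 h2 h3
  obtain ⟨s1, s2, s3, s4⟩ := hS q hq.1 r hr.1 h1 h2 h3
  have hq' := (mem_perp_iff.1 hq).2
  have hr' := (mem_perp_iff.1 hr).2
  -- The interval $(l,m]$ is convex and `r.src` lies between the endpoints of `q`, just as `q.tgt`
  -- lies between those of `r`. Hence all four endpoints are in the interval or none is, and this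
  -- holds for every arc formed from them.
  have key : (p.src < q.src ∧ q.src ≤ p.tgt) ↔ (p.src < r.src ∧ r.src ≤ p.tgt) := by
    constructor
    · intro h
      exact ⟨h.1.trans_le h1, h2.trans (hq'.1 h).2⟩
    · intro h
      exact hq'.2 ⟨h.1.trans_le h2, h3.trans (hr'.1 h).2⟩
  exact ⟨fun h => mem_perp_iff.2 ⟨s1 h, key⟩, fun h => mem_perp_iff.2 ⟨s2 h, key.symm.trans hq'⟩,
    fun h => mem_perp_iff.2 ⟨s3 h, hq'.symm.trans (key.trans hr')⟩,
    fun h => mem_perp_iff.2 ⟨s4 h, key.trans hr'⟩⟩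

theorem exists_isMinimalArc {S : Set Arc} (hf : S.Finite) (hne : S.Nonempty) :
    ∃ p, IsMinimalArc S p :=
  let ⟨p, hp, h⟩ := hf.exists_minimalFor (fun p => toLex (p.src, p.tgt)) S hne
  ⟨p, hp, fun _ hq => (le_total _ _).elim id fun hle => h hq hle⟩

theorem IsMinimalArc.src_le {S : Set Arc} {p q : Arc} (hp : IsMinimalArc S p) (hq : q ∈ S) :
    p.src ≤ q.src := by
  have := hp.2 q hq
  rw [Prod.Lex.toLex_le_toLex] at this
  rcases this with h | h
  · exact h.le
  · exact h.1.le

theorem IsMinimalArc.tgt_le {S : Set Arc} {p q : Arc} (hp : IsMinimalArc S p) (hq : q ∈ S)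
    (h : q.src = p.src) : p.tgt ≤ q.tgt := by
  have := hp.2 q hq
  rw [Prod.Lex.toLex_le_toLex] at this
  rcases this with h' | h'
  · exact absurd h.symm h'.ne
  · exact h'.2

/-- In a saturated set, an arc crossing the minimal arc from the right starts at its source. -/
theorem IsMinimalArc.src_eq_of_hom {S : Set Arc} (hS : IsSaturated S) {p q : Arc}
    (hp : IsMinimalArc S p) (hq : q ∈ S) (h1 : q.src < p.tgt) (h2 : p.tgt ≤ q.tgt) :
    p.src = q.src := by
  by_contra hne
  have hlt := lt_of_le_of_ne (hp.src_le hq) hne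
  -- Saturation puts the arc from `p.src` to `q.src` into the set; it has the source of `p`, so
  -- minimality forces `p.tgt ≤ q.src`.
  have := hp.tgt_le ((hS p hp.1 q hq hlt.le h1.le h2).1 hlt) rfl
  exact absurd h1 (not_lt.2 this)

/-- Nothing is lost when passing to the perpendicular. A discarded arc other than `p` starts where
`p` ends; joining it to `p` gives an arc of the perpendicular, and saturation of `T` cuts it apart
again. -/
theorem IsMinimalArc.mem_of_perp_subset {S T : Set Arc} (hS : IsSaturated S) (hT : IsSaturated T)
    {p : Arc} (hp : IsMinimalArc S p) (hpT : p ∈ T) (h : Arc.perp S p ⊆ T) : S ⊆ T := by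
  intro q hq
  by_cases hqp : q ∈ Arc.perp S p
  · exact h hqp
  have hpq := hp.src_le hq
  have hlt := p.lt
  have hq' : (p.src < q.src ∧ q.src ≤ p.tgt ∧ p.tgt < q.tgt) ∨
      (q.src ≤ p.src ∧ p.src < q.tgt ∧ q.tgt ≤ p.tgt) := by
    by_contra hcon
    rw [not_or] at hcon
    exact hqp ⟨hq, hcon⟩
  rcases hq' with ⟨h1, h2, h3⟩ | ⟨h1, h2, h3⟩
  · have h4 : q.src = p.tgt := by
      by_contra hne
      exact h1.ne (hp.src_eq_of_hom hS hq (lt_of_le_of_ne h2 hne) h3.le)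
    have h5 : (⟨p.src, q.tgt, hlt.trans h3⟩ : Arc) ∈ S :=
      (hS p hp.1 q hq h1.le h2 h3.le).2.2.2 _
    have h6 : (⟨p.src, q.tgt, hlt.trans h3⟩ : Arc) ∈ Arc.perp S p :=
      mem_perp_iff.2 ⟨h5, by simp [h3]⟩
    have h7 := (hT p hpT _ (h h6) le_rfl hlt.le h3.le).2.2.1 h3
    convert h7
  · have h4 : q.src = p.src := le_antisymm h1 hpq
    have h5 : q = p := Arc.ext h4 (le_antisymm h3 (hp.tgt_le hq h4))
    exact h5 ▸ hpT

/-- Induction on the cardinality: the minimal arc is not in its own perpendicular. The recorded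
relations between earlier and later arcs need checking only against the first arc, as all later arcs
lie in its perpendicular. -/
theorem exists_minimalArcSequence {S : Set Arc} (hf : S.Finite) (hS : IsSaturated S) :
    ∃ (n : ℕ) (E : Fin n → Arc), IsMinimalArcSequence S E ∧ (∀ i, E i ∈ S) ∧
      sat (Set.range E) = S ∧ ∀ i j, i < j →
        toLex ((E i).src, (E i).tgt) < toLex ((E j).src, (E j).tgt) ∧
        ¬ ((E i).src < (E j).src ∧ (E j).src ≤ (E i).tgt ∧ (E i).tgt < (E j).tgt) ∧
        ¬ ((E j).src ≤ (E i).src ∧ (E i).src < (E j).tgt ∧ (E j).tgt ≤ (E i).tgt) ∧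
        ((E j).src < (E i).tgt → (E i).tgt ≤ (E j).tgt → (E i).src = (E j).src) := by
  induction h : S.ncard using Nat.strong_induction_on generalizing S with
  | _ N ih =>
  rcases S.eq_empty_or_nonempty with rfl | hne
  · refine ⟨0, Fin.elim0, ⟨fun _ => ∅, rfl, fun i => i.elim0, rfl⟩, fun i => i.elim0, ?_,
      fun i => i.elim0⟩
    exact Set.subset_empty_iff.1 (sat_subset hS (by rintro _ ⟨i, -⟩; exact i.elim0))
  obtain ⟨p, hp⟩ := exists_isMinimalArc hf hne
  have hlt : (perp S p).ncard < N := by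
    rw [← h]
    exact Set.ncard_lt_ncard ⟨perp_subset S p, fun hle => notMem_perp S p (hle hp.1)⟩ hf
  obtain ⟨n, E, ⟨T, hT0, hT, hTn⟩, hE, hsat, hrel⟩ :=
    ih _ hlt (hf.subset (perp_subset S p)) (hS.perp p) rfl
  refine ⟨n + 1, Fin.cons p E, ⟨Fin.cons S T, rfl, fun i => ?_, hTn⟩, fun i => ?_, ?_, ?_⟩
  · cases i using Fin.cases with
    | zero => exact ⟨hp, hT0⟩
    | succ i => exact hT i
  · cases i using Fin.cases with
    | zero => exact hp.1
    | succ i => exact perp_subset S p (hE i)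
  · refine subset_antisymm (sat_subset hS ?_)
      (hp.mem_of_perp_subset hS (isSaturated_sat _) (subset_sat _ ⟨0, rfl⟩) ?_)
    · rintro _ ⟨i, rfl⟩
      cases i using Fin.cases with
      | zero => exact hp.1
      | succ i => exact perp_subset S p (hE i)
    · rw [← hsat]
      refine sat_subset (isSaturated_sat _) ?_
      rintro _ ⟨i, rfl⟩
      exact subset_sat _ ⟨i.succ, rfl⟩
  · intro i j hij
    cases j using Fin.cases with
    | zero => exact absurd hij (Fin.not_lt_zero i)
    | succ j =>
    cases i using Fin.cases with
    | succ i => exact hrel i j (Fin.succ_lt_succ_iff.1 hij)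
    | zero =>
      have hj := hE j
      refine ⟨lt_of_le_of_ne (hp.2 _ hj.1) fun heq => ?_, hj.2.1, hj.2.2,
        hp.src_eq_of_hom hS hj.1⟩
      have hpj : p = E j := Arc.ext (congrArg (fun x => (ofLex x).1) heq)
        (congrArg (fun x => (ofLex x).2) heq)
      exact notMem_perp S p (hpj ▸ hj)

end Arc

/-! ### Path algebras and endomorphism algebras as matrix algebras -/

namespace LinearQuiver

variable {r : ℕ}

theorem val_le_of_path {x y : LinearQuiver r} (p : Quiver.Path x y) : Fin.val x ≤ Fin.val y := by
  induction p with
  | nil => exact le_rfl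
  | cons p e ih => exact ih.trans (by have := e.down; omega)

instance (x y : LinearQuiver r) : Subsingleton (Quiver.Path x y) := by
  refine ⟨fun p q => ?_⟩
  induction p with
  | nil =>
    cases q with
    | nil => rfl
    | cons q e =>
      have h1 := val_le_of_path q
      have h2 := e.down
      omega
  | cons p e ih =>
    cases q with
    | nil =>
      have h1 := val_le_of_path p
      have h2 := e.down
      omega
    | @cons b _ q e' =>
      have h1 := e.down
      have h2 := e'.down
      obtain rfl := Fin.ext (n := r) (Nat.succ_injective (h1.trans h2.symm))
      rw [ih q, show e = e' from PLift.down_injective rfl]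

theorem nonempty_path (n : ℕ) : ∀ x y : LinearQuiver r, Fin.val x + n = Fin.val y →
    Nonempty (Quiver.Path x y) := by
  induction n with
  | zero =>
    intro x y h
    obtain rfl := Fin.ext (n := r) h
    exact ⟨Quiver.Path.nil⟩
  | succ n ih =>
    intro x y h
    let z : LinearQuiver r := (⟨Fin.val x + n, by have := Fin.isLt y; omega⟩ : Fin r)
    obtain ⟨p⟩ := ih x z rfl
    exact ⟨p.cons (PLift.up h : z ⟶ y)⟩

/-- A vertex of the linear quiver, counted from the end. -/
def rev (x : LinearQuiver r) : Fin r := Fin.rev x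

theorem rev_injective : Function.Injective (rev : LinearQuiver r → Fin r) := Fin.rev_injective

end LinearQuiver

namespace PathAlgebra

open LinearQuiver

variable {𝕜 : Type u} [Field 𝕜] {r : ℕ}

/-- The linear map underlying `toMatrix`. -/
noncomputable def toMatrixLin :
    PathAlgebra 𝕜 (LinearQuiver r) →ₗ[𝕜] Matrix (Fin r) (Fin r) 𝕜 :=
  Finsupp.linearCombination 𝕜 fun p => Matrix.single (rev p.1.1) (rev p.1.2) (1 : 𝕜)

theorem toMatrixLin_path (p : Σ x : LinearQuiver r × LinearQuiver r, Quiver.Path x.1 x.2) :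
    toMatrixLin (path p : PathAlgebra 𝕜 (LinearQuiver r)) =
      Matrix.single (rev p.1.1) (rev p.1.2) (1 : 𝕜) :=
  (Finsupp.linearCombination_single 𝕜 _ _).trans (one_smul _ _)

variable (𝕜 r) in
/-- The path algebra of the linear quiver as an algebra of triangular matrices. -/
noncomputable def toMatrix :
    PathAlgebra 𝕜 (LinearQuiver r) →ₐ[𝕜] Matrix (Fin r) (Fin r) 𝕜 :=
  AlgHom.ofLinearMap toMatrixLin
    (by
      refine (map_sum toMatrixLin _ _).trans ?_
      simp only [toMatrixLin_path]
      rw [← Matrix.sum_single_one]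
      exact Equiv.sum_comp (Fin.revPerm (n := r)) fun i => Matrix.single i i (1 : 𝕜))
    (by
      intro x y
      change toMatrixLin (mulLin x y) = _
      induction x using induction with
      | h0 => simp
      | ha x x' hx hx' => simp only [map_add, LinearMap.add_apply, hx, hx', add_mul]
      | hs c p =>
      induction y using induction with
      | h0 => simp
      | ha y y' hy hy' => simp only [map_add, hy, hy', mul_add]
      | hs d q =>
      simp only [map_smul, LinearMap.smul_apply, mulLin_path, toMatrixLin_path,
        smul_mul_assoc, mul_smul_comm]
      congr 2
      obtain ⟨⟨a, b⟩, p⟩ := p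
      obtain ⟨⟨b', c⟩, q⟩ := q
      by_cases h : b' = b
      · subst h
        simp [pathMul, toMatrixLin_path]
      · have h' : rev b ≠ rev b' := fun h' => h (rev_injective h').symm
        simp [pathMul, h, Matrix.single_mul_single_of_ne _ _ _ _ h'])

theorem toMatrix_path (p : Σ x : LinearQuiver r × LinearQuiver r, Quiver.Path x.1 x.2) :
    toMatrix 𝕜 r (path p) = Matrix.single (rev p.1.1) (rev p.1.2) (1 : 𝕜) := toMatrixLin_path p

/-- A linear quiver has at most one path between two vertices, so each matrix entry reads off a
single coefficient. Injectivity follows. -/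
theorem toMatrix_apply (a : PathAlgebra 𝕜 (LinearQuiver r))
    (p : Σ x : LinearQuiver r × LinearQuiver r, Quiver.Path x.1 x.2) :
    toMatrix 𝕜 r a (rev p.1.1) (rev p.1.2) = Finsupp.lapply (R := 𝕜) p a := by
  classical
  induction a using induction with
  | h0 => exact congrArg (fun A => A (rev p.1.1) (rev p.1.2)) (map_zero (toMatrix 𝕜 r))
  | ha a b ha hb => rw [map_add, Matrix.add_apply, ha, hb]; exact (map_add _ _ _).symm
  | hs c q =>
    rw [map_smul, toMatrix_path, Matrix.smul_apply]
    refine Eq.trans ?_ (map_smul (Finsupp.lapply (R := 𝕜) p) c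
      (Finsupp.single q (1 : 𝕜))).symm
    congr 1
    rw [Finsupp.lapply_apply, Finsupp.single_apply, Matrix.single_apply]
    refine if_congr ⟨fun h => ?_, fun h => ?_⟩ rfl rfl
    · obtain ⟨⟨a, b⟩, p⟩ := p
      obtain ⟨⟨a', b'⟩, q⟩ := q
      obtain rfl := rev_injective h.1
      obtain rfl := rev_injective h.2
      rw [Subsingleton.elim p q]
    · rw [h]
      exact ⟨rfl, rfl⟩

theorem toMatrix_injective : Function.Injective (toMatrix 𝕜 r) := fun a b h =>
  Finsupp.ext fun p => (toMatrix_apply a p).symm.trans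
    ((congrArg (fun A => A (rev p.1.1) (rev p.1.2)) h).trans (toMatrix_apply b p))

/-- Paths run from smaller to larger vertices, and counting vertices from the end turns this into
lower triangular matrices. That is the shape of the matrix of an endomorphism of a direct sum whose
components go from smaller to larger indices. -/
theorem mem_range_toMatrix {A : Matrix (Fin r) (Fin r) 𝕜} :
    A ∈ (toMatrix 𝕜 r).range ↔ ∀ i j, A i j ≠ 0 → j ≤ i := by
  constructor
  · rintro ⟨a, rfl⟩ i j
    contrapose!
    intro hij
    induction a using induction with
    | h0 => exact congrArg (fun A => A i j) (map_zero (toMatrix 𝕜 r))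
    | ha a b ha hb =>
      refine (congrArg (fun A => A i j) (map_add (toMatrix 𝕜 r) a b)).trans ?_
      exact (congrArg₂ (· + ·) ha hb).trans (add_zero _)
    | hs c p =>
      refine (congrArg (fun A => A i j) (map_smul (toMatrix 𝕜 r) c (path p))).trans ?_
      rw [toMatrix_path, Matrix.smul_apply, Matrix.single_apply, if_neg, smul_zero]
      rintro ⟨rfl, rfl⟩
      exact absurd (val_le_of_path p.2) (not_le_of_gt (Fin.rev_lt_rev.1 hij))
  · intro h
    rw [Matrix.matrix_eq_sum_single A]
    refine sum_mem fun i _ => sum_mem fun j _ => ?_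
    by_cases hij : A i j = 0
    · rw [hij, Matrix.single_zero]
      exact zero_mem _
    · have hle := h i j hij
      let x : LinearQuiver r := Fin.rev i
      let y : LinearQuiver r := Fin.rev j
      have hle' : Fin.val x ≤ Fin.val y := Fin.rev_le_rev.2 hle
      obtain ⟨p⟩ := nonempty_path (Fin.val y - Fin.val x) x y (by omega)
      refine ⟨A i j • path ⟨(x, y), p⟩, ?_⟩
      refine (map_smul (toMatrix 𝕜 r) _ _).trans ?_
      rw [toMatrix_path, Matrix.smul_single, smul_eq_mul, mul_one]
      congr 1
      · exact Fin.rev_rev i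
      · exact Fin.rev_rev j

variable (𝕜) in
/-- A product of path algebras of linear quivers as an algebra of block diagonal matrices. -/
noncomputable def piToMatrix {k : ℕ} (r : Fin k → ℕ) :
    ((j : Fin k) → PathAlgebra 𝕜 (LinearQuiver (r j))) →ₐ[𝕜]
      Matrix (Σ j, Fin (r j)) (Σ j, Fin (r j)) 𝕜 :=
  AlgHom.mk' ((Matrix.blockDiagonal'RingHom (fun j => Fin (r j)) 𝕜).comp
    (RingHom.pi fun j => ((toMatrix 𝕜 (r j)) : _ →+* _).comp (Pi.evalRingHom _ j)))
    (by
      intro c x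
      refine Eq.trans ?_ (Matrix.blockDiagonal'_smul c fun j => toMatrix 𝕜 (r j) (x j))
      exact congrArg Matrix.blockDiagonal' (funext fun j => map_smul (toMatrix 𝕜 (r j)) c (x j)))

theorem piToMatrix_apply {k : ℕ} (r : Fin k → ℕ)
    (x : (j : Fin k) → PathAlgebra 𝕜 (LinearQuiver (r j))) :
    piToMatrix 𝕜 r x = Matrix.blockDiagonal' fun j => toMatrix 𝕜 (r j) (x j) := rfl

theorem piToMatrix_injective {k : ℕ} (r : Fin k → ℕ) : Function.Injective (piToMatrix 𝕜 r) :=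
  fun _ _ h => funext fun j =>
    toMatrix_injective (congrFun (Matrix.blockDiagonal'_injective h) j)

theorem mem_range_piToMatrix {k : ℕ} {r : Fin k → ℕ}
    {A : Matrix (Σ j, Fin (r j)) (Σ j, Fin (r j)) 𝕜} :
    A ∈ (piToMatrix 𝕜 r).range ↔
      ∀ s t, A s t ≠ 0 → t.1 = s.1 ∧ t.2.val ≤ s.2.val := by
  constructor
  · rintro ⟨x, rfl⟩ ⟨i, a⟩ ⟨j, b⟩ h
    change piToMatrix 𝕜 r x _ _ ≠ 0 at h
    rw [piToMatrix_apply, Matrix.blockDiagonal'_apply] at h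
    split_ifs at h with hij
    · obtain rfl : i = j := hij
      exact ⟨rfl, mem_range_toMatrix.1 ⟨x i, rfl⟩ a b h⟩
    · exact absurd rfl h
  · intro h
    have hj : ∀ j, ∃ a, toMatrix 𝕜 (r j) a = fun x y => A ⟨j, x⟩ ⟨j, y⟩ := fun j =>
      mem_range_toMatrix.2 fun x y hxy => (h _ _ hxy).2
    choose a ha using hj
    refine ⟨a, ?_⟩
    change piToMatrix 𝕜 r a = A
    rw [piToMatrix_apply]
    ext ⟨i, x⟩ ⟨j, y⟩
    by_cases hij : i = j
    · subst hij
      rw [Matrix.blockDiagonal'_apply_eq, ha]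
    · rw [Matrix.blockDiagonal'_apply_ne _ _ _ hij]
      by_contra hne
      exact hij (h _ _ (Ne.symm hne)).1.symm

end PathAlgebra

/-! ### Endomorphism algebras of direct sums as incidence algebras. -/

section EndBiproduct

variable {𝕜 : Type u} [Field 𝕜] {C : Type*} [Category C] [Preadditive C] [Linear 𝕜 C]
  {ι : Type} [Fintype ι] [DecidableEq ι] (E : ι → C) [HasBiproduct E]

/-- Endomorphisms of a direct sum as matrices, given multiplicative coordinates on the morphisms
between the summands. -/
noncomputable def endBiproductToMatrix (c : ∀ i j, (E i ⟶ E j) →ₗ[𝕜] 𝕜)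
    (hid : ∀ i, c i i (𝟙 _) = 1)
    (hcomp : ∀ i j k (f : E i ⟶ E j) (g : E j ⟶ E k), c i k (f ≫ g) = c i j f * c j k g) :
    End (⨁ E) →ₐ[𝕜] Matrix ι ι 𝕜 :=
  AlgHom.ofLinearMap
    { toFun := fun f => Matrix.of fun i j => c j i (biproduct.ι E j ≫ f ≫ biproduct.π E i)
      map_add' := fun f g => by
        ext i j
        have : biproduct.ι E j ≫ ((f + g : (⨁ E) ⟶ ⨁ E)) ≫ biproduct.π E i =
            biproduct.ι E j ≫ f ≫ biproduct.π E i + biproduct.ι E j ≫ g ≫ biproduct.π E i := by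
          rw [Preadditive.add_comp, Preadditive.comp_add]
        exact (congrArg (c j i) this).trans (map_add _ _ _)
      map_smul' := fun a f => by
        ext i j
        have : biproduct.ι E j ≫ ((a • f : (⨁ E) ⟶ ⨁ E)) ≫ biproduct.π E i =
            a • (biproduct.ι E j ≫ f ≫ biproduct.π E i) := by
          rw [Linear.smul_comp, Linear.comp_smul]
        exact (congrArg (c j i) this).trans (map_smul _ _ _) }
    (by
      ext i j
      change c j i (biproduct.ι E j ≫ 𝟙 _ ≫ biproduct.π E i) = _
      rw [Category.id_comp]
      by_cases h : i = j
      · subst h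
        rw [biproduct.ι_π_self, hid, Matrix.one_apply_eq]
      · rw [biproduct.ι_π_ne _ (Ne.symm h), map_zero, Matrix.one_apply_ne h])
    (by
      intro f g
      ext i j
      -- The product `f * g` in `End` is `g ≫ f`, so the entry in row `i` and column `j` has to be
      -- the component from the `j`-th to the `i`-th summand.
      change c j i (biproduct.ι E j ≫ (g ≫ f : (⨁ E) ⟶ ⨁ E) ≫ biproduct.π E i) = _
      have : biproduct.ι E j ≫ (g ≫ f : (⨁ E) ⟶ ⨁ E) ≫ biproduct.π E i =
          ∑ k, (biproduct.ι E j ≫ g ≫ biproduct.π E k) ≫ (biproduct.ι E k ≫ f ≫ biproduct.π E i) := by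
        calc _ = biproduct.ι E j ≫ g ≫ 𝟙 _ ≫ f ≫ biproduct.π E i := by simp
          _ = _ := by
            rw [← biproduct.total]
            simp only [Preadditive.sum_comp, Preadditive.comp_sum, Category.assoc]
      rw [this, map_sum, Matrix.mul_apply]
      refine Finset.sum_congr rfl fun k _ => ?_
      rw [hcomp, mul_comm]
      rfl)

theorem endBiproductToMatrix_apply (c : ∀ i j, (E i ⟶ E j) →ₗ[𝕜] 𝕜) (hid) (hcomp)
    (f : (⨁ E) ⟶ ⨁ E) (i j : ι) : endBiproductToMatrix E c hid hcomp f i j =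
      c j i (biproduct.ι E j ≫ f ≫ biproduct.π E i) := rfl

/-- The endomorphism algebra of a direct sum is isomorphic to an incidence algebra if the
morphisms between the summands are spanned by a compatible family. -/
theorem exists_end_biproduct_toMatrix {R : ι → ι → Prop} (hR : ∀ i, R i i)
    (e : ∀ i j, R i j → (E i ⟶ E j)) (he : ∀ i j h, e i j h ≠ 0)
    (hspan : ∀ i j h f, ∃ a : 𝕜, f = a • e i j h) (h0 : ∀ i j, ¬ R i j → ∀ f : E i ⟶ E j, f = 0)
    (hid : ∀ i, e i i (hR i) = 𝟙 _)
    (hcomp : ∀ i j k h h', ∃ h'', e i j h ≫ e j k h' = e i k h'') :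
    ∃ φ : End (⨁ E) →ₐ[𝕜] Matrix ι ι 𝕜, Function.Injective φ ∧
      ∀ A, A ∈ φ.range ↔ ∀ i j, A i j ≠ 0 → R j i := by
  classical
  have hb : ∀ i j h, Function.Bijective (LinearMap.toSpanSingleton 𝕜 (E i ⟶ E j) (e i j h)) :=
    fun i j h => ⟨LinearMap.ker_eq_bot.1 (LinearMap.ker_toSpanSingleton 𝕜 (he i j h)),
      fun f => (hspan i j h f).imp fun a ha => ha.symm⟩
  let c : ∀ i j, (E i ⟶ E j) →ₗ[𝕜] 𝕜 := fun i j =>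
    if h : R i j then (LinearEquiv.ofBijective _ (hb i j h)).symm.toLinearMap else 0
  have hc : ∀ i j h (a : 𝕜), c i j (a • e i j h) = a := by
    intro i j h a
    have : c i j = (LinearEquiv.ofBijective _ (hb i j h)).symm.toLinearMap := dif_pos h
    rw [this]
    exact (LinearEquiv.ofBijective _ (hb i j h)).symm_apply_apply a
  have hcid : ∀ i, c i i (𝟙 _) = 1 := fun i => by
    rw [← hid, ← hc i i (hR i) 1, one_smul]
  have hinj : ∀ i j (f : E i ⟶ E j), c i j f = 0 → f = 0 := by
    intro i j f hf
    by_cases h : R i j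
    · obtain ⟨a, rfl⟩ := hspan i j h f
      rw [hc] at hf
      rw [hf, zero_smul]
    · exact h0 i j h f
  -- If one factor is not allowed by `R` it is zero, so both sides vanish even when `R i k` holds.
  -- Otherwise the spanning morphisms compose to a spanning morphism.
  have hccomp : ∀ i j k (f : E i ⟶ E j) (g : E j ⟶ E k), c i k (f ≫ g) = c i j f * c j k g := by
    intro i j k f g
    by_cases h : R i j
    · by_cases h' : R j k
      · obtain ⟨a, rfl⟩ := hspan i j h f
        obtain ⟨b, rfl⟩ := hspan j k h' g
        obtain ⟨h'', hh⟩ := hcomp i j k h h'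
        rw [Linear.smul_comp, Linear.comp_smul, hh, smul_smul, hc, hc, hc]
      · rw [h0 j k h' g, comp_zero, map_zero, map_zero, mul_zero]
    · rw [h0 i j h f, zero_comp, map_zero, map_zero, zero_mul]
  refine ⟨endBiproductToMatrix E c hcid hccomp, (injective_iff_map_eq_zero _).2 fun f hf => ?_,
    fun A => ⟨?_, fun hA => ?_⟩⟩
  · refine biproduct.hom_ext' _ _ fun j => biproduct.hom_ext _ _ fun i => ?_
    rw [Category.assoc, hinj _ _ _ (congrFun (congrFun hf i) j), Category.assoc]
    exact ((congrArg (_ ≫ ·) zero_comp).trans comp_zero).symm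
  · rintro ⟨f, rfl⟩ i j
    contrapose!
    intro h
    exact (congrArg (c j i) (h0 j i h _)).trans (map_zero _)
  · refine ⟨biproduct.desc fun j => biproduct.lift fun i =>
      if h : R j i then A i j • e j i h else 0, ?_⟩
    ext i j
    refine (endBiproductToMatrix_apply E c hcid hccomp _ i j).trans ?_
    rw [← Category.assoc, biproduct.ι_desc, biproduct.lift_π]
    by_cases h : R j i
    · rw [dif_pos h, hc]
    · rw [dif_neg h, map_zero]
      by_contra hne
      exact h (hA i j (Ne.symm hne))

end EndBiproduct

/-- The nonempty fibres of `f` are the blocks, each enumerated increasingly. Applied to the sources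
of the arcs, this cuts the collection into its chains. -/
theorem exists_fiber_equiv {n : ℕ} {α : Type*} (f : Fin n → α) :
    ∃ (k : ℕ) (r : Fin k → ℕ) (σ : (Σ j, Fin (r j)) ≃ Fin n), (∀ j, 0 < r j) ∧ ∑ j, r j = n ∧
      ∀ s t, (f (σ s) = f (σ t) ∧ σ s ≤ σ t) ↔ (s.1 = t.1 ∧ s.2.val ≤ t.2.val) := by
  classical
  let V := Finset.univ.image f
  let e := V.equivFin.symm
  let S : Fin V.card → Finset (Fin n) := fun j => Finset.univ.filter fun i => f i = e j
  have hS : ∀ j i, i ∈ S j ↔ f i = e j := fun j i => by simp [S]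
  let τ : (Σ j, Fin (S j).card) → Fin n := fun s => (S s.1).orderEmbOfFin rfl s.2
  have hτ : ∀ s, f (τ s) = e s.1 := fun s =>
    (hS _ _).1 (Finset.orderEmbOfFin_mem (S s.1) rfl s.2)
  have hfst : ∀ s t, f (τ s) = f (τ t) → s.1 = t.1 := fun s t h =>
    e.injective (Subtype.ext ((hτ s).symm.trans (h.trans (hτ t))))
  have hbij : Function.Bijective τ := by
    constructor
    · rintro ⟨i, x⟩ ⟨j, y⟩ h
      obtain rfl : i = j := hfst _ _ (congrArg f h)
      exact congrArg (Sigma.mk i) (((S i).orderEmbOfFin rfl).injective h)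
    · intro i
      let v : V := ⟨f i, Finset.mem_image_of_mem f (Finset.mem_univ i)⟩
      have hi : i ∈ S (e.symm v) := (hS _ _).2 (by rw [e.apply_symm_apply])
      rw [← Finset.mem_coe, ← Finset.range_orderEmbOfFin (S (e.symm v)) rfl] at hi
      obtain ⟨x, hx⟩ := hi
      exact ⟨⟨_, x⟩, hx⟩
  let σ := Equiv.ofBijective τ hbij
  refine ⟨V.card, fun j => (S j).card, σ, fun j => ?_, ?_, fun s t => ⟨fun h => ?_, fun h => ?_⟩⟩
  · obtain ⟨i, -, hi⟩ := Finset.mem_image.1 (e j).2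
    exact Finset.card_pos.2 ⟨i, (hS j i).2 hi⟩
  · have := Fintype.card_congr σ
    simpa using this
  · obtain ⟨i, x⟩ := s
    obtain ⟨j, y⟩ := t
    obtain rfl : i = j := hfst _ _ h.1
    exact ⟨rfl, ((S i).orderEmbOfFin rfl).le_iff_le.1 h.2⟩
  · obtain ⟨i, x⟩ := s
    obtain ⟨j, y⟩ := t
    obtain rfl : i = j := h.1
    exact ⟨(hτ ⟨i, x⟩).trans (hτ ⟨i, y⟩).symm, ((S i).orderEmbOfFin rfl).le_iff_le.2 h.2⟩

/-! ### The strong exceptional collection of a saturated set -/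

theorem Arc.exists_end_equiv_pi_pathAlgebra (𝕜 : Type u) [Field 𝕜] {n : ℕ} (E : Fin n → Arc)
    (hlex : ∀ i j, i < j → toLex ((E i).src, (E i).tgt) < toLex ((E j).src, (E j).tgt))
    (hback : ∀ i j, i < j →
      ¬ ((E j).src ≤ (E i).src ∧ (E i).src < (E j).tgt ∧ (E j).tgt ≤ (E i).tgt))
    (hsrc : ∀ i j, i < j → (E j).src < (E i).tgt → (E i).tgt ≤ (E j).tgt →
      (E i).src = (E j).src) :
    ∃ (k : ℕ) (r : Fin k → ℕ), (∀ j, 0 < r j) ∧ ∑ j, r j = n ∧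
      Nonempty (End (⨁ fun i => (E i).obj 𝕜) ≃ₐ[𝕜]
        ((j : Fin k) → PathAlgebra 𝕜 (LinearQuiver (r j)))) := by
  have htgt : ∀ i j, (E i).src = (E j).src ∧ i ≤ j → (E i).tgt ≤ (E j).tgt := by
    rintro i j ⟨h, hij⟩
    rcases hij.eq_or_lt with rfl | hij
    · exact le_rfl
    · rcases Prod.Lex.toLex_lt_toLex.1 (hlex i j hij) with h' | h'
      · exact absurd h h'.ne
      · exact h'.2.le
  obtain ⟨φ, hφ, hφr⟩ := exists_end_biproduct_toMatrix (𝕜 := 𝕜) (fun i => (E i).obj 𝕜)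
    (R := fun i j => (E i).src = (E j).src ∧ i ≤ j) (fun _ => ⟨rfl, le_rfl⟩)
    (fun i j h => objHomOfLE 𝕜 h.1.le (htgt i j h))
    (fun i j h => objHomOfLE_ne_zero _ _ (h.1 ▸ (E i).lt))
    (fun i j h f => exists_eq_smul_objHomOfLE _ _ f)
    -- A nonzero forward morphism forces equal sources by `hsrc`, and a backward one is excluded by
    -- `hback`; so morphisms live only within a chain.
    (fun i j h f => obj_hom_eq_zero (fun h' => h (by
      rcases lt_trichotomy i j with hij | rfl | hij
      · exact ⟨hsrc i j hij h'.2.1 h'.2.2, hij.le⟩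
      · exact ⟨rfl, le_rfl⟩
      · exact absurd h' (hback j i hij))) f)
    (fun i => objHomOfLE_refl (E i))
    (fun i j k h h' => ⟨⟨h.1.trans h'.1, h.2.trans h'.2⟩, objHomOfLE_comp _ _ _ _⟩)
  obtain ⟨k, r, σ, hr, hsum, hσ⟩ := exists_fiber_equiv fun i => (E i).src
  let ρ := Matrix.reindexAlgEquiv 𝕜 𝕜 σ.symm
  have hψ : Function.Injective (ρ.toAlgHom.comp φ) := ρ.injective.comp hφ
  -- Both algebras embed into the same matrix algebra. They are isomorphic because their images are
  -- cut out by the same vanishing of entries.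
  have hrange : (ρ.toAlgHom.comp φ).range = (PathAlgebra.piToMatrix 𝕜 r).range := by
    ext A
    rw [PathAlgebra.mem_range_piToMatrix]
    have h1 : A ∈ (ρ.toAlgHom.comp φ).range ↔ ρ.symm A ∈ φ.range := by
      constructor
      · rintro ⟨f, rfl⟩
        exact ⟨f, (ρ.symm_apply_apply _).symm⟩
      · rintro ⟨f, hf⟩
        exact ⟨f, (congrArg ρ hf).trans (ρ.apply_symm_apply A)⟩
    rw [h1, hφr]
    constructor
    · intro h s t hst
      refine (hσ t s).1 (h (σ s) (σ t) ?_)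
      simpa [ρ] using hst
    · intro h i j hij
      have := (hσ _ _).2 (h (σ.symm i) (σ.symm j) hij)
      simpa using this
  exact ⟨k, r, hr, hsum, ⟨(AlgEquiv.ofInjective _ hψ).trans
    ((Subalgebra.equivOfEq _ _ hrange).trans
      (AlgEquiv.ofInjective _ (PathAlgebra.piToMatrix_injective r)).symm)⟩⟩

theorem mainTheorem4 (𝕜 : Type u) [Field 𝕜] (F : Set Arc) (hF : F.Finite) :
    ∃ (n : ℕ) (E : Fin n → Arc),
      Arc.IsMinimalArcSequence (Arc.sat F) E ∧
      (∀ i, E i ∈ Arc.sat F) ∧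
      IsStrongExceptionalCollection 𝕜 (fun i => (E i).obj 𝕜) ∧
      Arc.sat (Set.range E) = Arc.sat F ∧
      ∃ (k : ℕ) (r : Fin k → ℕ), (∀ j, 0 < r j) ∧ ∑ j, r j = n ∧
        Nonempty (End (⨁ fun i => (E i).obj 𝕜) ≃ₐ[𝕜]
          ((j : Fin k) → PathAlgebra 𝕜 (LinearQuiver (r j)))) := by
  obtain ⟨n, E, hseq, hmem, hsat, hE⟩ :=
    Arc.exists_minimalArcSequence (Arc.finite_sat hF) (Arc.isSaturated_sat F)
  refine ⟨n, E, hseq, hmem, ⟨⟨fun i => (E i).isExceptional_obj, fun i j hij m f => ?_⟩,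
    fun i j hij m hm f => Arc.shiftedHom_eq_zero (fun h => ?_) hm f⟩, hsat,
    Arc.exists_end_equiv_pi_pathAlgebra 𝕜 E (fun i j h => (hE i j h).1)
      (fun i j h => (hE i j h).2.2.1) (fun i j h => (hE i j h).2.2.2)⟩
  · obtain ⟨-, h1, h2, -⟩ := hE i j hij
    -- The two conditions defining the perpendicular are used separately: one excludes a morphism in
    -- degree $0$, the other excludes morphisms in all other degrees.
    by_cases hm : m = 0
    · subst hm
      let e := (shiftFunctorZero (DbGrS 𝕜) ℤ).app ((E i).obj 𝕜)
      exact (cancel_mono e.hom).1 ((Arc.obj_hom_eq_zero h2 (f ≫ e.hom)).trans zero_comp.symm)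
    · exact Arc.shiftedHom_eq_zero h1 hm f
  -- A forward extension would require the later arc to have strictly smaller source, against the
  -- lexicographic order.
  · rcases hij.eq_or_lt with rfl | hij
    · exact lt_irrefl _ h.1
    · rcases Prod.Lex.toLex_lt_toLex.1 (hE i j hij).1 with h' | h'
      · exact lt_asymm h' h.1
      · exact h.1.ne h'.1.symm
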